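/- Let $K$ be a finitely generated field extension of $\mathbb{Q}$ and let $q\in K\smallsetminus\{0,1\}$. Endow $K(x)$ with the automorphism $\sigma_q:f(x)\mapsto f(qx)$ and with the derivation $\partial=x\frac{d}{dx}$, which commutes with $\sigma_q$. A $q$-difference module over $K(x)$ is a pair $\mathcal{M}=(M,\Sigma_q)$ where $M$ is a finite dimensional $K(x)$-vector space and $\Sigma_q:M\to M$ is a bijective additive map with $\Sigma_q(fm)=\sigma_q(f)\Sigma_q(m)$. It is called trivial if $M$ has a $K(x)$-basis $\underline{e}$ with $\Sigma_q\underline{e}=\underline{e}$. For a vector space $V$ over $K(x)$, let $F_\partial(V)=K(x)[\partial]_{\le 1}\otimes_{K(x)}V$, with elements $v+\partial(w)$ ($v,w\in V$) and with $K(x)$-structure given by $\lambda\,\partial(w)=\partial(\lambda w)-\partial(\lambda)w$. If $V$ is a $q$-difference module, so is $F_\partial(V)$, by $\Sigma_q(v+\partial(w))=\Sigma_q(v)+\partial(\Sigma_q(w))$. Let $Constr^{\partial}(\mathcal{M})$ be the smallest family of $q$-difference modules that contains $\mathcal{M}$ and is closed under direct sums, tensor products, symmetric and antisymmetric powers, duals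 and $F_\partial$. The parameterized generic Galois group $Gal^{\partial}(\mathcal{M},\eta_{K(x)})$ is the differential group scheme over $K(x)$ whose points in a commutative $K(x)$-algebra $A$ with a derivation extending $\partial$ are the $g\in GL(M\otimes_{K(x)} A)$ such that, for every object $W$ of $Constr^{\partial}(\mathcal{M})$ and every sub-$q$-difference module $N$ of $W$, the induced automorphism of $W\otimes_{K(x)} A$ maps $N\otimes_{K(x)} A$ into itself. Then $Gal^{\partial}(\mathcal{M},\eta_{K(x)})=\{1\}$ (that is, its group of $A$-points is $\{1\}$ for every such $A$) if and only if $\mathcal{M}$ is a trivial $q$-difference module. -/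

import Mathlib

open scoped TensorProduct Polynomial

universe u

noncomputable section

namespace QDiff

/-! ### Functoriality of the linear constructions for semilinear maps -/

section Semilinear

variable {R S : Type u} [CommRing R] [CommRing S] {φ : R →+* S}
variable {U V : Type u} [AddCommGroup U] [Module R U] [AddCommGroup V] [Module S V]

/-- The ring homomorphism `Λ(U) → Λ(V)` induced by a `φ`-semilinear map `f : U → V`. -/
def extAlgMap (f : U →ₛₗ[φ] V) : ExteriorAlgebra R U →+* ExteriorAlgebra S V :=
  letI : Algebra R (ExteriorAlgebra S V) := Algebra.compHom _ φ
  let f' : U →ₗ[R] ExteriorAlgebra S V :=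
    { toFun := fun u => ExteriorAlgebra.ι S (f u)
      map_add' := fun a b => by simp
      map_smul' := fun r a => by
        rw [map_smulₛₗ, map_smul]; rfl }
  (ExteriorAlgebra.lift R ⟨f', fun m => ExteriorAlgebra.ι_sq_zero (f m)⟩).toRingHom

theorem extAlgMap_ι (f : U →ₛₗ[φ] V) (u : U) :
    extAlgMap f (ExteriorAlgebra.ι R u) = ExteriorAlgebra.ι S (f u) := by
  let _ : Algebra R (ExteriorAlgebra S V) := Algebra.compHom _ φ
  exact ExteriorAlgebra.lift_ι_apply R _ _ u

theorem extAlgMap_algebraMap (f : U →ₛₗ[φ] V) (r : R) :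
    extAlgMap f (algebraMap R _ r) = algebraMap S _ (φ r) := by
  let _ : Algebra R (ExteriorAlgebra S V) := Algebra.compHom _ φ
  exact AlgHom.commutes (ExteriorAlgebra.lift R _) r

/-- The ring homomorphism `Sym(U) → Sym(V)` induced by a `φ`-semilinear map `f : U → V`. -/
def symAlgMap (f : U →ₛₗ[φ] V) : SymmetricAlgebra R U →+* SymmetricAlgebra S V :=
  letI : Algebra R (SymmetricAlgebra S V) := Algebra.compHom _ φ
  let f' : U →ₗ[R] SymmetricAlgebra S V :=
    { toFun := fun u => SymmetricAlgebra.ι S V (f u)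
      map_add' := fun a b => by simp
      map_smul' := fun r a => by
        rw [map_smulₛₗ, map_smul, Algebra.smul_def, Algebra.smul_def]; rfl }
  (SymmetricAlgebra.lift f').toRingHom

theorem symAlgMap_ι (f : U →ₛₗ[φ] V) (u : U) :
    symAlgMap f (SymmetricAlgebra.ι R U u) = SymmetricAlgebra.ι S V (f u) := by
  let _ : Algebra R (SymmetricAlgebra S V) := Algebra.compHom _ φ
  exact SymmetricAlgebra.lift_ι_apply _ u

theorem symAlgMap_algebraMap (f : U →ₛₗ[φ] V) (r : R) :
    symAlgMap f (algebraMap R _ r) = algebraMap S _ (φ r) := by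
  let _ : Algebra R (SymmetricAlgebra S V) := Algebra.compHom _ φ
  exact AlgHom.commutes (SymmetricAlgebra.lift _) r

theorem map_mem_pow {A B : Type u} [Ring A] [Ring B] [Algebra R A] [Algebra S B] (F : A →+* B)
    (hF : ∀ r, F (algebraMap R A r) = algebraMap S B (φ r)) (P : Submodule R A)
    (Q : Submodule S B) (hPQ : ∀ p ∈ P, F p ∈ Q) (n : ℕ) {x : A} (hx : x ∈ P ^ n) :
    F x ∈ Q ^ n := by
  induction hx using Submodule.pow_induction_on_left' with
  | algebraMap r => rw [hF, pow_zero]; exact Submodule.algebraMap_mem _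
  | add x y i hx hy h1 h2 => rw [map_add]; exact add_mem h1 h2
  | mem_mul m hm i x hx h =>
    rw [map_mul, pow_succ']
    exact Submodule.mul_mem_mul (hPQ m hm) h

/-- The map `Λⁿ(U) → Λⁿ(V)` induced by a `φ`-semilinear map `f : U → V`. -/
def extMap (n : ℕ) (f : U →ₛₗ[φ] V) : (⋀[R]^n U) →ₛₗ[φ] (⋀[S]^n V) where
  toFun x := ⟨extAlgMap f x.1, map_mem_pow (extAlgMap f) (extAlgMap_algebraMap f) _ _ (by
    rintro _ ⟨u, rfl⟩
    exact ⟨f u, (extAlgMap_ι f u).symm⟩) n x.2⟩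
  map_add' x y := Subtype.ext (map_add _ _ _)
  map_smul' r x := Subtype.ext (by
    simp [Algebra.smul_def, extAlgMap_algebraMap])

/-- The `n`-th symmetric power of `U`: the homogeneous part of degree `n` of `Sym(U)`. -/
def symPower (R : Type u) [CommRing R] (n : ℕ) (U : Type u) [AddCommGroup U] [Module R U] :
    Submodule R (SymmetricAlgebra R U) :=
  LinearMap.range (SymmetricAlgebra.ι R U) ^ n

/-- The map `Symⁿ(U) → Symⁿ(V)` induced by a `φ`-semilinear map `f : U → V`. -/
def symMap (n : ℕ) (f : U →ₛₗ[φ] V) : symPower R n U →ₛₗ[φ] symPower S n V where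
  toFun x := ⟨symAlgMap f x.1, map_mem_pow (symAlgMap f) (symAlgMap_algebraMap f) _ _ (by
    rintro _ ⟨u, rfl⟩
    exact ⟨f u, (symAlgMap_ι f u).symm⟩) n x.2⟩
  map_add' x y := Subtype.ext (map_add _ _ _)
  map_smul' r x := Subtype.ext (by
    simp [Algebra.smul_def, symAlgMap_algebraMap])

/-- The map `U × U' → V × V'` induced by two `φ`-semilinear maps. -/
def sumMap {U' V' : Type u} [AddCommGroup U'] [Module R U'] [AddCommGroup V'] [Module S V']
    (f : U →ₛₗ[φ] V) (g : U' →ₛₗ[φ] V') : (U × U') →ₛₗ[φ] (V × V') where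
  toFun x := (f x.1, g x.2)
  map_add' x y := by simp
  map_smul' r x := by simp

open Classical in
/-- The contragredient `f^∨ : U* → V*` of a `φ`-semilinear map `f : U → V` which sends a basis of
`U` to a basis of `V` (such as a linear or semilinear automorphism, or the canonical map from `U`
to an extension of scalars of `U`). It is the unique `φ`-semilinear map such that
`⟨f^∨ ξ, f u⟩ = φ ⟨ξ, u⟩`, see `dualMap_apply` and `dualMap_unique` (and `0` if there is none). -/
def dualMap (f : U →ₛₗ[φ] V) : Module.Dual R U →ₛₗ[φ] Module.Dual S V :=
  if h : ∃ h : Module.Dual R U →ₛₗ[φ] Module.Dual S V, ∀ ξ u, h ξ (f u) = φ (ξ u)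
  then h.choose else 0

theorem dualMap_apply {ι : Type*} [Finite ι] (f : U →ₛₗ[φ] V) (b : Module.Basis ι R U)
    (c : Module.Basis ι S V) (hf : ∀ i, f (b i) = c i) (ξ : Module.Dual R U) (u : U) :
    dualMap f ξ (f u) = φ (ξ u) := by
  have h : ∃ h : Module.Dual R U →ₛₗ[φ] Module.Dual S V, ∀ ξ u, h ξ (f u) = φ (ξ u) := by
    cases nonempty_fintype ι
    have key : ∀ (ξ : Module.Dual R U) (u : U),
        c.constr S (fun i => φ (ξ (b i))) (f u) = φ (ξ u) := by
      intro ξ u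
      conv_lhs => rw [← b.sum_repr u]
      conv_rhs => rw [← b.sum_repr u]
      rw [map_sum, map_sum, map_sum, map_sum]
      refine Finset.sum_congr rfl fun i _ => ?_
      rw [map_smulₛₗ, map_smul, map_smul, hf, Module.Basis.constr_basis]
      simp
    refine ⟨{ toFun := fun ξ => c.constr S (fun i => φ (ξ (b i))), map_add' := ?_,
              map_smul' := ?_ }, key⟩
    · intro x y
      refine c.ext fun i => ?_
      simp only [LinearMap.add_apply, Module.Basis.constr_basis, map_add]
    · intro r x
      refine c.ext fun i => ?_
      simp only [LinearMap.smul_apply, Module.Basis.constr_basis, smul_eq_mul, map_mul]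
  unfold dualMap
  rw [dif_pos h]
  exact h.choose_spec ξ u

theorem dualMap_unique {ι : Type*} [Finite ι] (f : U →ₛₗ[φ] V) (b : Module.Basis ι R U)
    (c : Module.Basis ι S V) (hf : ∀ i, f (b i) = c i) (h : Module.Dual R U →ₛₗ[φ] Module.Dual S V)
    (hh : ∀ ξ u, h ξ (f u) = φ (ξ u)) : h = dualMap f := by
  ext1 ξ
  refine c.ext fun i => ?_
  rw [← hf, hh, dualMap_apply f b c hf]

end Semilinear

/-! ### The prolongation functor -/

section Prolongation

/-- The prolongation `F_∂(U) = R[∂]_{≤ 1} ⊗_R U` of a module `U` over a differential ring `R`.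
Since `1, ∂` is a basis of the right `R`-module `R[∂]_{≤ 1}`, every element is uniquely of the form
`1 ⊗ v + ∂ ⊗ w = v + ∂(w)`; it is represented by the pair `(v, w)`. -/
def Prolongation (_R U : Type u) : Type u := U × U

variable {R : Type u} [CommRing R] [Differential R] {U : Type u} [AddCommGroup U] [Module R U]

instance : AddCommGroup (Prolongation R U) := inferInstanceAs (AddCommGroup (U × U))

/-- The left `R`-module structure: `r ∂(w) = ∂(r w) - ∂(r) w`. -/
instance : Module R (Prolongation R U) where
  smul r x := ((r • x.1 - Differential.deriv r • x.2, r • x.2) : U × U)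
  one_smul x := by
    refine Prod.ext ?_ ?_
    · change (1 : R) • x.1 - Differential.deriv (1 : R) • x.2 = x.1
      simp
    · exact one_smul R x.2
  mul_smul r s x := by
    refine Prod.ext ?_ ?_
    · change (r * s) • x.1 - Differential.deriv (r * s) • x.2 =
        r • (s • x.1 - Differential.deriv s • x.2) - Differential.deriv r • (s • x.2)
      rw [Derivation.leibniz, smul_eq_mul, smul_eq_mul]
      module
    · exact mul_smul r s x.2
  smul_zero r := by
    refine Prod.ext ?_ ?_
    · change r • (0 : U) - Differential.deriv r • (0 : U) = 0
      simp
    · exact smul_zero r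
  smul_add r x y := by
    refine Prod.ext ?_ ?_
    · change r • (x.1 + y.1) - Differential.deriv r • (x.2 + y.2) =
        (r • x.1 - Differential.deriv r • x.2) + (r • y.1 - Differential.deriv r • y.2)
      module
    · exact smul_add r x.2 y.2
  add_smul r s x := by
    refine Prod.ext ?_ ?_
    · change (r + s) • x.1 - Differential.deriv (r + s) • x.2 =
        (r • x.1 - Differential.deriv r • x.2) + (s • x.1 - Differential.deriv s • x.2)
      rw [map_add]
      module
    · exact add_smul r s x.2
  zero_smul x := by
    refine Prod.ext ?_ ?_
    · change (0 : R) • x.1 - Differential.deriv (0 : R) • x.2 = 0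
      simp
    · exact zero_smul R x.2

/-- The element `v + ∂(w)` of `F_∂(U)`. -/
def Prolongation.mk (R : Type u) {U : Type u} (v w : U) : Prolongation R U := (v, w)

/-- The Leibniz rule `∂(r w) = r ∂(w) + ∂(r) w`. -/
theorem Prolongation.leibniz (r : R) (w : U) :
    Prolongation.mk R 0 (r • w) =
      r • Prolongation.mk R 0 w + Differential.deriv r • Prolongation.mk R w 0 := by
  refine Prod.ext ?_ ?_
  · change (0 : U) = (r • (0 : U) - Differential.deriv r • w) +
      (Differential.deriv r • w - Differential.deriv (Differential.deriv r) • (0 : U))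
    simp
  · change r • w = r • w + Differential.deriv r • (0 : U)
    simp

/-- The functor `F_∂` on morphisms, for maps which are semilinear with respect to a homomorphism of
differential rings: `v + ∂(w)` is sent to `f(v) + ∂(f(w))`. -/
def prolMap {S : Type u} [CommRing S] [Differential S] {V : Type u} [AddCommGroup V] [Module S V]
    {φ : R →+* S} (hφ : ∀ r, φ (Differential.deriv r) = Differential.deriv (φ r))
    (f : U →ₛₗ[φ] V) : Prolongation R U →ₛₗ[φ] Prolongation S V where
  toFun x := ((f x.1, f x.2) : V × V)
  map_add' x y := Prod.ext (map_add f x.1 y.1) (map_add f x.2 y.2)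
  map_smul' r x := by
    refine Prod.ext ?_ ?_
    · change f (r • x.1 - Differential.deriv r • x.2) =
        φ r • f x.1 - Differential.deriv (φ r) • f x.2
      rw [map_sub, map_smulₛₗ, map_smulₛₗ, hφ]
    · exact map_smulₛₗ f r x.2

end Prolongation

/-! ### Constructions of differential linear algebra -/

/-- The formal constructions of differential linear algebra in one variable: the closure of the
variable under direct sums, tensor products, symmetric and antisymmetric powers, duals and the
prolongation functor. -/
inductive Construction : Type
  | self : Construction
  | sum : Construction → Construction → Construction
  | tensor : Construction → Construction → Construction
  | sym : ℕ → Construction → Construction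
  | alt : ℕ → Construction → Construction
  | dual : Construction → Construction
  | prol : Construction → Construction

namespace Construction

/-- The module `C(U)` obtained by applying a construction `C` to a module `U` over a differential
ring `R`. -/
def obj (R : Type u) [CommRing R] [Differential R] (U : ModuleCat.{u} R) :
    Construction → ModuleCat.{u} R
  | self => U
  | sum C D => ModuleCat.of R (obj R U C × obj R U D)
  | tensor C D => ModuleCat.of R (obj R U C ⊗[R] obj R U D)
  | sym n C => ModuleCat.of R (symPower R n (obj R U C))
  | alt n C => ModuleCat.of R (⋀[R]^n (obj R U C))
  | dual C => ModuleCat.of R (Module.Dual R (obj R U C))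
  | prol C => ModuleCat.of R (Prolongation R (obj R U C))

/-- The map `C(f) : C(U) → C(V)` induced by a map `f : U → V` which is semilinear with respect to a
homomorphism `φ : R → S` of differential rings (and which sends a basis to a basis, as required for
the dual). It gives at the same time the `q`-difference operator of `C(M)`, the action of `GL(V)`
on `C(V)`, and the comparison of `C(V)` with the same construction over an extension of scalars. -/
def map {R S : Type u} [CommRing R] [Differential R] [CommRing S] [Differential S] (φ : R →+* S)
    (hφ : ∀ r, φ (Differential.deriv r) = Differential.deriv (φ r))
    {U : ModuleCat.{u} R} {V : ModuleCat.{u} S} (f : U →ₛₗ[φ] V) :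
    (C : Construction) → (obj R U C →ₛₗ[φ] obj S V C)
  | self => f
  | sum C D => sumMap (map φ hφ f C) (map φ hφ f D)
  | tensor C D => TensorProduct.map (map φ hφ f C) (map φ hφ f D)
  | sym n C => symMap n (map φ hφ f C)
  | alt n C => extMap n (map φ hφ f C)
  | dual C => dualMap (map φ hφ f C)
  | prol C => prolMap hφ (map φ hφ f C)

end Construction

/-! ### q-difference modules and the parameterized generic Galois group -/

/-- A `q`-difference module over a field `F` with an endomorphism `σ`: a finite dimensional
`F`-vector space with an invertible `σ`-semilinear operator. -/
structure QDifferenceModule (F : Type u) [Field F] (σ : F →+* F) where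
  carrier : Type u
  [addCommGroup : AddCommGroup carrier]
  [module : Module F carrier]
  [finiteDimensional : FiniteDimensional F carrier]
  op : carrier →ₛₗ[σ] carrier
  bijective_op : Function.Bijective op

attribute [instance] QDifferenceModule.addCommGroup QDifferenceModule.module
  QDifferenceModule.finiteDimensional

namespace QDifferenceModule

variable {F : Type u} [Field F] {σ : F →+* F}

/-- A `q`-difference module is trivial if it has a basis fixed by its operator. -/
def IsTrivial (M : QDifferenceModule F σ) : Prop :=
  ∃ e : Module.Basis (Fin (Module.finrank F M.carrier)) F M.carrier, ∀ i, M.op (e i) = e i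

variable [Differential F]

/-- The underlying vector space of the construction `C` applied to `M`. -/
abbrev constr (M : QDifferenceModule F σ) (C : Construction) : ModuleCat.{u} F :=
  C.obj F (ModuleCat.of F M.carrier)

/-- The `q`-difference operator of the construction `C` applied to `M`. -/
def constrOp (hσ : ∀ f, σ (Differential.deriv f) = Differential.deriv (σ f))
    (M : QDifferenceModule F σ) (C : Construction) : M.constr C →ₛₗ[σ] M.constr C :=
  C.map σ hσ (U := ModuleCat.of F M.carrier) (V := ModuleCat.of F M.carrier) M.op

variable (A : Type u) [CommRing A] [Algebra F A] [Differential A] [DifferentialAlgebra F A]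

/-- The same construction applied to the extension of scalars `A ⊗ M`. -/
abbrev constrExt (M : QDifferenceModule F σ) (C : Construction) : ModuleCat.{u} A :=
  C.obj A (ModuleCat.of A (A ⊗[F] M.carrier))

/-- The canonical map `M → A ⊗ M`, `m ↦ 1 ⊗ m`. -/
def toExt (M : QDifferenceModule F σ) : M.carrier →ₛₗ[algebraMap F A] (A ⊗[F] M.carrier) where
  toFun m := 1 ⊗ₜ m
  map_add' x y := TensorProduct.tmul_add 1 x y
  map_smul' r x := by
    rw [algebraMap_smul, TensorProduct.tmul_smul]

/-- The canonical map `C(M) → C(A ⊗ M)`, which identifies `C(A ⊗ M)` with `A ⊗ C(M)`. -/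
def constrToExt (M : QDifferenceModule F σ) (C : Construction) :
    M.constr C →ₛₗ[algebraMap F A] M.constrExt A C :=
  C.map (algebraMap F A) (fun f => (deriv_algebraMap f).symm)
    (U := ModuleCat.of F M.carrier) (V := ModuleCat.of A (A ⊗[F] M.carrier)) (M.toExt A)

/-- The action of `g ∈ GL(M)(A)` on `C(A ⊗ M)`. -/
def constrAct (M : QDifferenceModule F σ) (g : LinearMap.GeneralLinearGroup A (A ⊗[F] M.carrier))
    (C : Construction) : M.constrExt A C →ₗ[A] M.constrExt A C :=
  C.map (RingHom.id A) (fun _ => rfl) (U := ModuleCat.of A (A ⊗[F] M.carrier))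
    (V := ModuleCat.of A (A ⊗[F] M.carrier)) (g : Module.End A (A ⊗[F] M.carrier))

/-- The `A`-points of the parameterized generic Galois group `Gal^∂(M)`, for a differential
`F`-algebra `A`: the elements of `GL(M)(A)` which stabilize `N ⊗ A` for each sub-`q`-difference
module `N` of each construction of differential linear algebra of `M`. -/
def paramGenericGaloisGroup (hσ : ∀ f, σ (Differential.deriv f) = Differential.deriv (σ f))
    (M : QDifferenceModule F σ) : Set (LinearMap.GeneralLinearGroup A (A ⊗[F] M.carrier)) :=
  {g | ∀ (C : Construction) (N : Submodule F (M.constr C)),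
    (∀ n ∈ N, M.constrOp hσ C n ∈ N) →
    ∀ y ∈ Submodule.span A (M.constrToExt A C '' (N : Set (M.constr C))),
      M.constrAct A g C y ∈ Submodule.span A (M.constrToExt A C '' (N : Set (M.constr C)))}

end QDifferenceModule

/-! ### The field of rational functions -/

section RationalFunctions

variable {K : Type u} [Field K]

/-- The automorphism `σ_q : f(x) ↦ f(qx)` of `K(x)`. -/
def sigma (q : K) (hq : q ≠ 0) : RatFunc K →+* RatFunc K :=
  letI : Invertible q := invertibleOfNonzero hq
  (IsFractionRing.ringEquivOfRingEquiv (K := RatFunc K) (L := RatFunc K)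
    (Polynomial.algEquivCMulXAddC q 0).toRingEquiv : RatFunc K ≃+* RatFunc K)

theorem sigma_algebraMap (q : K) (hq : q ≠ 0) (p : K[X]) :
    sigma q hq (algebraMap K[X] (RatFunc K) p) =
      algebraMap K[X] (RatFunc K) (p.comp (Polynomial.C q * Polynomial.X)) := by
  let _ : Invertible q := invertibleOfNonzero hq
  simp [sigma, Polynomial.comp, Polynomial.aeval_def]

/-- The function underlying the derivation `x d/dx` of `K(x)`: the quotient rule. -/
def eulerFun (f : RatFunc K) : RatFunc K :=
  RatFunc.X * algebraMap K[X] (RatFunc K)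
    (f.num.derivative * f.denom - f.num * f.denom.derivative) /
      algebraMap K[X] (RatFunc K) (f.denom ^ 2)

theorem eulerFun_div (p r : K[X]) (hr : r ≠ 0) :
    eulerFun (algebraMap K[X] (RatFunc K) p / algebraMap K[X] (RatFunc K) r) =
      RatFunc.X * algebraMap K[X] (RatFunc K) (p.derivative * r - p * r.derivative) /
        algebraMap K[X] (RatFunc K) (r ^ 2) := by
  have inj := RatFunc.algebraMap_injective K
  set f : RatFunc K := algebraMap K[X] (RatFunc K) p / algebraMap K[X] (RatFunc K) r with hf
  have hr' : algebraMap K[X] (RatFunc K) r ≠ 0 := (map_ne_zero_iff _ inj).2 hr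
  have hd : f.denom ≠ 0 := f.denom_ne_zero
  have hd' : algebraMap K[X] (RatFunc K) f.denom ≠ 0 := (map_ne_zero_iff _ inj).2 hd
  have h : f.num * r = p * f.denom := by
    apply inj
    rw [map_mul, map_mul]
    have h1 := RatFunc.num_div_denom f
    rw [hf, div_eq_div_iff (hf ▸ hd') hr'] at h1
    exact h1
  have h' := congrArg Polynomial.derivative h
  rw [Polynomial.derivative_mul, Polynomial.derivative_mul] at h'
  have key : (f.num.derivative * f.denom - f.num * f.denom.derivative) * r ^ 2 =
      (p.derivative * r - p * r.derivative) * f.denom ^ 2 := by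
    linear_combination (r * f.denom) * h' -
      (f.denom.derivative * r + f.denom * r.derivative) * h
  have key' := congrArg (algebraMap K[X] (RatFunc K)) key
  rw [map_mul, map_mul (algebraMap K[X] (RatFunc K)) _ (f.denom ^ 2)] at key'
  unfold eulerFun
  rw [div_eq_div_iff (by simpa using hd) (by simpa using hr), mul_assoc, key', mul_assoc]

theorem eulerFun_algebraMap (p : K[X]) :
    eulerFun (algebraMap K[X] (RatFunc K) p) =
      RatFunc.X * algebraMap K[X] (RatFunc K) p.derivative := by
  have h := eulerFun_div p 1 one_ne_zero
  simpa using h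

theorem exists_div (f : RatFunc K) : ∃ p r : K[X], r ≠ 0 ∧
    f = algebraMap K[X] (RatFunc K) p / algebraMap K[X] (RatFunc K) r :=
  ⟨f.num, f.denom, f.denom_ne_zero, (RatFunc.num_div_denom f).symm⟩

theorem eulerFun_mul (f g : RatFunc K) :
    eulerFun (f * g) = f * eulerFun g + g * eulerFun f := by
  obtain ⟨p, r, hr, rfl⟩ := exists_div f
  obtain ⟨s, t, ht, rfl⟩ := exists_div g
  rw [div_mul_div_comm, ← map_mul, ← map_mul, eulerFun_div _ _ (mul_ne_zero hr ht),
    eulerFun_div _ _ hr, eulerFun_div _ _ ht]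
  have hr' : algebraMap K[X] (RatFunc K) r ≠ 0 := by simpa using hr
  have ht' : algebraMap K[X] (RatFunc K) t ≠ 0 := by simpa using ht
  simp only [Polynomial.derivative_mul, map_mul, map_sub, map_add, map_pow]
  field_simp
  ring

theorem eulerFun_add (f g : RatFunc K) :
    eulerFun (f + g) = eulerFun f + eulerFun g := by
  obtain ⟨p, r, hr, rfl⟩ := exists_div f
  obtain ⟨s, t, ht, rfl⟩ := exists_div g
  have hr' : algebraMap K[X] (RatFunc K) r ≠ 0 := by simpa using hr
  have ht' : algebraMap K[X] (RatFunc K) t ≠ 0 := by simpa using ht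
  rw [div_add_div _ _ hr' ht', ← map_mul, ← map_mul, ← map_mul, ← map_add,
    eulerFun_div _ _ (mul_ne_zero hr ht), eulerFun_div _ _ hr, eulerFun_div _ _ ht]
  simp only [Polynomial.derivative_mul, map_mul, map_sub, map_add, map_pow]
  field_simp
  ring

/-- A differential ring from a map which is additive and satisfies the Leibniz rule. -/
abbrev differentialOfLeibniz {R : Type u} [CommRing R] (D : R → R)
    (hadd : ∀ f g, D (f + g) = D f + D g) (hmul : ∀ f g, D (f * g) = f * D g + g * D f) :
    Differential R where
  deriv := Derivation.mk' (AddMonoidHom.toIntLinearMap (AddMonoidHom.mk' D hadd)) hmul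

theorem deriv_mul {R : Type u} [CommRing R] [Differential R] (f g : R) :
    Differential.deriv (f * g) = f * Differential.deriv g + g * Differential.deriv f := by
  rw [Derivation.leibniz, smul_eq_mul, smul_eq_mul]

/-- The field `K(x)` is endowed with the derivation `∂ = x d/dx`. -/
instance eulerDifferential : Differential (RatFunc K) :=
  differentialOfLeibniz eulerFun eulerFun_add eulerFun_mul

theorem deriv_algebraMap_ratFunc (p : K[X]) :
    Differential.deriv (algebraMap K[X] (RatFunc K) p) =
      RatFunc.X * algebraMap K[X] (RatFunc K) p.derivative :=
  eulerFun_algebraMap p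

/-- The derivation `x d/dx` commutes with `σ_q`. -/
theorem sigma_deriv (q : K) (hq : q ≠ 0) (f : RatFunc K) :
    sigma q hq (Differential.deriv f) = Differential.deriv (sigma q hq f) := by
  have hpoly : ∀ p : K[X], sigma q hq (Differential.deriv (algebraMap K[X] (RatFunc K) p)) =
      Differential.deriv (sigma q hq (algebraMap K[X] (RatFunc K) p)) := by
    intro p
    rw [deriv_algebraMap_ratFunc, sigma_algebraMap, deriv_algebraMap_ratFunc, map_mul,
      ← RatFunc.algebraMap_X, sigma_algebraMap, sigma_algebraMap, ← map_mul, ← map_mul,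
      Polynomial.derivative_comp]
    congr 1
    simp
    ring
  obtain ⟨p, r, hr, hf⟩ := exists_div f
  have hr' : algebraMap K[X] (RatFunc K) r ≠ 0 := by simpa using hr
  have h : f * algebraMap K[X] (RatFunc K) r = algebraMap K[X] (RatFunc K) p := by
    rw [hf, div_mul_cancel₀ _ hr']
  have h1 := hpoly p
  rw [← h, deriv_mul, map_mul (sigma q hq) f, deriv_mul, map_add, map_mul, map_mul, hpoly r] at h1
  have h2 : sigma q hq (algebraMap K[X] (RatFunc K) r) ≠ 0 :=
    (map_ne_zero_iff _ (sigma q hq).injective).2 hr'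
  exact mul_left_cancel₀ h2 (add_left_cancel h1)

end RationalFunctions

end QDiff

end

/-! Write F = K(x). The argument works over any differential field F with an endomorphism σ
commuting with ∂.

If M has a fixed basis e, then the vector (e_i, 1) of M ⊕ Λ⁰M is fixed and spans a stable line.
Since g acts as the identity on Λ⁰, stabilizing this line forces g e_i = e_i
(`paramGenericGaloisGroup_eq_of_isTrivial`).

The converse requires enough points of the group. Let a be the matrix of the operator in a basis b
of M, and let L be the fraction field of the differential polynomials in the entries of a generic
matrix Z, with σ(Z) = a⁻¹Z. Then Y = Z is an invertible matrix with Y = aσ(Y)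
(`exists_fundamental_matrix`), and its columns form a fixed basis e of L ⊗ M. Let E be the subfield
of L generated over F by the constants, that is, the elements fixed by σ. It is closed under ∂, so A
= L ⊗_E L is a differential F-algebra with two embeddings φ₁, φ₂ of L that agree on constants. The
automorphism g with matrix φ₁(Y)φ₂(Y)⁻¹ lies in the group (`mem_paramGenericGaloisGroup`): for N
stable in C(M), the space L ⊗ N is spanned by fixed vectors (`le_span_fixed`), these have constant
coordinates in the basis of C(L ⊗ M) induced by e, and so C(g) carries their φ₂-images to their
φ₁-images. If the group is trivial, then Y ⊗ 1 = 1 ⊗ Y, so Y has entries in E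
(`mem_of_tmul_one_eq`).

A second use of descent clears denominators: the entries of Y are F-linear combinations of constants
(`mem_span_constants_of_mem_adjoin`). Expanding Y along F-independent constants yields fixed vectors
of M itself, and they span M because det Y ≠ 0 (`isTrivial_of_mem_adjoin`). No control over the new
constants of L is needed. -/

noncomputable section

namespace QDiff

/-! ### Bases of sums, tensor products, symmetric and exterior powers, and duals. -/

section Bases

variable {R S : Type u} [CommRing R] [CommRing S] {φ : R →+* S}
variable {U V : Type u} [AddCommGroup U] [Module R U] [AddCommGroup V] [Module S V]

theorem symmetricAlgebra_basis_apply {ι : Type*} (b : Module.Basis ι R U) (d : ι →₀ ℕ) :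
    b.symmetricAlgebra d = d.prod fun i k => SymmetricAlgebra.ι R U (b i) ^ k := by
  change (SymmetricAlgebra.equivMvPolynomial b).symm (MvPolynomial.monomial d 1) = _
  rw [MvPolynomial.monomial_eq, MvPolynomial.C_1, one_mul, Finsupp.prod, map_prod, Finsupp.prod]
  simp

theorem symmetricAlgebra_basis_add {ι : Type*} (b : Module.Basis ι R U) (d e : ι →₀ ℕ) :
    b.symmetricAlgebra (d + e) = b.symmetricAlgebra d * b.symmetricAlgebra e := by
  simp only [symmetricAlgebra_basis_apply]
  classical
  exact Finsupp.prod_add_index' (by simp) (by intros; rw [pow_add])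

/-- Induction on n: the basis turns addition of exponents into products, and every exponent of
degree n + 1 is one of degree n plus a unit vector. -/
theorem symPower_eq_span {ι : Type*} (b : Module.Basis ι R U) (n : ℕ) :
    Submodule.span R (Set.range fun d : {d : ι →₀ ℕ // d.degree = n} => b.symmetricAlgebra d) =
      symPower R n U := by
  have hset : ∀ n, (Set.range fun d : {d : ι →₀ ℕ // d.degree = n} => b.symmetricAlgebra d) =
      b.symmetricAlgebra '' {d | d.degree = n} := fun n => by
    rw [← Subtype.range_coe_subtype, ← Set.range_comp]; rfl
  have hsub : ∀ d : ι →₀ ℕ, d ≠ 0 → ∃ i e, d = e + Finsupp.single i 1 := fun d hd => by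
    obtain ⟨i, hi⟩ := Finsupp.ne_iff.1 hd
    obtain ⟨e, rfl⟩ := exists_add_of_le
      (Finsupp.single_le_iff.2 (Nat.one_le_iff_ne_zero.2 hi) : Finsupp.single i 1 ≤ d)
    exact ⟨i, e, add_comm _ _⟩
  rw [hset, symPower]
  have h1 : LinearMap.range (SymmetricAlgebra.ι R U) =
      Submodule.span R (b.symmetricAlgebra '' {d | d.degree = 1}) := by
    rw [LinearMap.range_eq_map, ← b.span_eq, Submodule.map_span, ← Set.range_comp]
    congr 1
    ext x
    constructor
    · rintro ⟨i, rfl⟩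
      exact ⟨Finsupp.single i 1, by simp, by simp [symmetricAlgebra_basis_apply]⟩
    · rintro ⟨d, hd, rfl⟩
      obtain ⟨i, e, rfl⟩ := hsub d (by rintro rfl; simp at hd)
      simp only [Set.mem_ofPred_eq, map_add, Finsupp.degree_single, Nat.add_eq_right,
        Finsupp.degree_eq_zero_iff] at hd
      exact ⟨i, by simp [symmetricAlgebra_basis_apply, hd]⟩
  induction n with
  | zero =>
    rw [pow_zero, Submodule.one_eq_span]
    congr 1
    have h0 : {d : ι →₀ ℕ | d.degree = 0} = {0} := by
      ext d
      exact Finsupp.degree_eq_zero_iff d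
    rw [h0, Set.image_singleton, symmetricAlgebra_basis_apply, Finsupp.prod_zero_index]
  | succ n ih =>
    rw [pow_succ, ← ih, h1, Submodule.span_mul_span]
    congr 1
    ext x
    constructor
    · rintro ⟨d, hd, rfl⟩
      obtain ⟨i, e, rfl⟩ := hsub d (by rintro rfl; simp at hd)
      refine ⟨_, ⟨e, ?_, rfl⟩, _, ⟨Finsupp.single i 1, by simp, rfl⟩, ?_⟩
      · simp only [Set.mem_ofPred_eq, map_add, Finsupp.degree_single] at hd ⊢; omega
      · exact (symmetricAlgebra_basis_add b _ _).symm
    · rintro ⟨_, ⟨d, hd, rfl⟩, _, ⟨e, he, rfl⟩, rfl⟩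
      refine ⟨d + e, ?_, symmetricAlgebra_basis_add b d e⟩
      simp only [Set.mem_ofPred_eq, map_add] at hd he ⊢; omega

/-- The monomials of degree `n` in a basis of `U` form a basis of the symmetric power. -/
def symPowerBasis {ι : Type*} (b : Module.Basis ι R U) (n : ℕ) :
    Module.Basis {d : ι →₀ ℕ // d.degree = n} R (symPower R n U) :=
  (Module.Basis.span (b.symmetricAlgebra.linearIndependent.comp
    (fun d : {d : ι →₀ ℕ // d.degree = n} => d.1) Subtype.val_injective)).map
    (LinearEquiv.ofEq _ _ (symPower_eq_span b n))

theorem coe_symPowerBasis {ι : Type*} (b : Module.Basis ι R U) (n : ℕ)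
    (d : {d : ι →₀ ℕ // d.degree = n}) :
    (symPowerBasis b n d : SymmetricAlgebra R U) = b.symmetricAlgebra d := by
  simp [symPowerBasis, Module.Basis.span_apply]

theorem symMap_basis {ι : Type*} (f : U →ₛₗ[φ] V) (b : Module.Basis ι R U) (c : Module.Basis ι S V)
    (hf : ∀ i, f (b i) = c i) (n : ℕ) (d : {d : ι →₀ ℕ // d.degree = n}) :
    symMap n f (symPowerBasis b n d) = symPowerBasis c n d := by
  refine Subtype.ext ?_
  change symAlgMap f (symPowerBasis b n d : SymmetricAlgebra R U) = _
  rw [coe_symPowerBasis, coe_symPowerBasis, symmetricAlgebra_basis_apply,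
    symmetricAlgebra_basis_apply, Finsupp.prod, Finsupp.prod, map_prod]
  simp [symAlgMap_ι, hf]

theorem extMap_basis {ι : Type*} [LinearOrder ι] (f : U →ₛₗ[φ] V) (b : Module.Basis ι R U)
    (c : Module.Basis ι S V) (hf : ∀ i, f (b i) = c i) (n : ℕ) (s : Set.powersetCard ι n) :
    extMap n f (b.exteriorPower n s) = c.exteriorPower n s := by
  refine Subtype.ext ?_
  change extAlgMap f (b.exteriorPower n s : ⋀[R]^n U).1 = (c.exteriorPower n s : ⋀[S]^n V).1
  rw [exteriorPower.basis_apply, exteriorPower.basis_apply]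
  simp only [exteriorPower.ιMulti_family, exteriorPower.ιMulti_apply_coe,
    ExteriorAlgebra.ιMulti_apply, map_list_prod, List.map_ofFn]
  congr 2
  funext i
  simp [extAlgMap_ι, hf]

theorem sumMap_basis {U' V' : Type u} [AddCommGroup U'] [Module R U'] [AddCommGroup V'] [Module S V']
    {ι ι' : Type*} (f : U →ₛₗ[φ] V) (b : Module.Basis ι R U) (c : Module.Basis ι S V)
    (hf : ∀ i, f (b i) = c i) (g : U' →ₛₗ[φ] V') (b' : Module.Basis ι' R U')
    (c' : Module.Basis ι' S V') (hg : ∀ i, g (b' i) = c' i) (j : ι ⊕ ι') :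
    sumMap f g (b.prod b' j) = c.prod c' j := by
  rcases j with j | j <;> refine Prod.ext ?_ ?_ <;> simp [sumMap, hf, hg]

theorem tensorMap_basis {U' V' : Type u} [AddCommGroup U'] [Module R U'] [AddCommGroup V']
    [Module S V'] {ι ι' : Type*} (f : U →ₛₗ[φ] V) (b : Module.Basis ι R U)
    (c : Module.Basis ι S V) (hf : ∀ i, f (b i) = c i) (g : U' →ₛₗ[φ] V')
    (b' : Module.Basis ι' R U') (c' : Module.Basis ι' S V') (hg : ∀ i, g (b' i) = c' i)
    (j : ι × ι') : TensorProduct.map f g (b.tensorProduct b' j) = c.tensorProduct c' j := by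
  rw [Module.Basis.tensorProduct_apply', Module.Basis.tensorProduct_apply', TensorProduct.map_tmul,
    hf, hg]

theorem dualMap_basis {ι : Type*} [Finite ι] [DecidableEq ι] (f : U →ₛₗ[φ] V)
    (b : Module.Basis ι R U) (c : Module.Basis ι S V) (hf : ∀ i, f (b i) = c i) (i : ι) :
    dualMap f (b.dualBasis i) = c.dualBasis i := by
  refine c.ext fun j => ?_
  rw [← hf, dualMap_apply f b c hf, hf]
  simp [Finsupp.single_apply]

end Bases

/-! ### Coordinates on the prolongation. -/

section Prolongation

variable {R : Type u} [CommRing R] [Differential R] {U : Type u} [AddCommGroup U] [Module R U]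

theorem Prolongation.smul_def (r : R) (x : Prolongation R U) :
    r • x = ((r • x.1 - Differential.deriv r • x.2, r • x.2) : U × U) := rfl

/-- The coordinates of `v + ∂(w)` in the basis `b_i, ∂(b_i)`. -/
def prolEquivFun {ι : Type*} [Fintype ι] (b : Module.Basis ι R U) :
    Prolongation R U ≃ₗ[R] (ι ⊕ ι → R) where
  -- For w = ∑ w_i b_i the Leibniz rule gives ∂(w) = ∑ w_i ∂(b_i) + ∑ ∂(w_i) b_i; hence the
  -- correction ∂(w_i) in the coordinate along b_i.
  toFun x := Sum.elim (fun i => b.equivFun x.1 i + Differential.deriv (b.equivFun x.2 i))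
    (b.equivFun x.2)
  invFun y := ((b.equivFun.symm fun i => y (.inl i) - Differential.deriv (y (.inr i)),
    b.equivFun.symm fun i => y (.inr i)) : U × U)
  map_add' x y := by
    change Sum.elim (fun i => b.equivFun (x.1 + y.1) i +
      Differential.deriv (b.equivFun (x.2 + y.2) i)) (b.equivFun (x.2 + y.2)) = _
    funext i
    rcases i with i | i
    · simp only [Sum.elim_inl, Pi.add_apply, map_add]; ring
    · simp
  map_smul' r x := by
    rw [Prolongation.smul_def]
    funext i
    rcases i with i | i
    · simp only [Sum.elim_inl, Pi.smul_apply, map_sub, map_smul, Pi.sub_apply, smul_eq_mul,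
        deriv_mul, RingHom.id_apply]
      ring
    · simp
  left_inv x := by
    refine Prod.ext ?_ ?_ <;> simp
  right_inv y := by
    funext i
    rcases i with i | i <;> simp only [LinearEquiv.apply_symm_apply, Sum.elim_inl, Sum.elim_inr,
      sub_add_cancel]

/-- The basis `b_i, ∂(b_i)` of `F_∂(U)`. -/
def prolBasis {ι : Type*} [Fintype ι] (b : Module.Basis ι R U) :
    Module.Basis (ι ⊕ ι) R (Prolongation R U) :=
  Module.Basis.ofEquivFun (prolEquivFun b)

theorem prolEquivFun_mk {ι : Type*} [Fintype ι] (b : Module.Basis ι R U) (v w : U) :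
    prolEquivFun b (Prolongation.mk R v w) =
      Sum.elim (fun i => b.equivFun v i + Differential.deriv (b.equivFun w i)) (b.equivFun w) :=
  rfl

theorem prolBasis_inl {ι : Type*} [Fintype ι] (b : Module.Basis ι R U) (i : ι) :
    prolBasis b (.inl i) = Prolongation.mk R (b i) 0 := by
  classical
  rw [prolBasis, Module.Basis.coe_ofEquivFun]
  refine (prolEquivFun b).symm_apply_eq.2 ?_
  rw [prolEquivFun_mk]
  funext j
  rcases j with j | j <;> simp [Pi.single_apply, eq_comm]

theorem prolBasis_inr {ι : Type*} [Fintype ι] (b : Module.Basis ι R U) (i : ι) :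
    prolBasis b (.inr i) = Prolongation.mk R 0 (b i) := by
  classical
  rw [prolBasis, Module.Basis.coe_ofEquivFun]
  refine (prolEquivFun b).symm_apply_eq.2 ?_
  rw [prolEquivFun_mk]
  funext j
  rcases j with j | j
  · by_cases h : i = j <;> simp [h]
  · simp [Pi.single_apply, Finsupp.single_apply, eq_comm]

theorem prolMap_basis {ι : Type*} [Fintype ι] {S : Type u} [CommRing S] [Differential S]
    {V : Type u} [AddCommGroup V] [Module S V] {φ : R →+* S}
    (hφ : ∀ r, φ (Differential.deriv r) = Differential.deriv (φ r))
    (f : U →ₛₗ[φ] V) (b : Module.Basis ι R U) (c : Module.Basis ι S V)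
    (hf : ∀ i, f (b i) = c i) (i : ι ⊕ ι) :
    prolMap hφ f (prolBasis b i) = prolBasis c i := by
  rcases i with i | i
  · rw [prolBasis_inl, prolBasis_inl]
    exact Prod.ext (hf i) (map_zero f)
  · rw [prolBasis_inr, prolBasis_inr]
    exact Prod.ext (map_zero f) (hf i)

end Prolongation

/-! ### Functoriality of the constructions on free modules of finite rank. -/

namespace Construction

theorem finite_degree_eq (ι : Type) [Finite ι] (k : ℕ) :
    Finite {d : ι →₀ ℕ // d.degree = k} := by
  classical
  cases nonempty_fintype ι
  refine Finite.of_injective (β := Finset.finsuppAntidiag (Finset.univ : Finset ι) k)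
    (fun d => ⟨d.1, ?_⟩) fun d e h => Subtype.ext (by simpa using h)
  simpa [Finset.mem_finsuppAntidiag, Finsupp.degree_eq_sum] using d.2

/-- A construction sends free modules to free modules: there is a choice of a basis of `C(U)` for
each basis of `U` which is compatible with the semilinear maps that send a basis to a basis. -/
theorem exists_basis (ι : Type) [Finite ι] (C : Construction) : ∃ (J : Type) (_ : Finite J)
    (B : ∀ {R : Type u} [CommRing R] [Differential R] {U : ModuleCat.{u} R},
      Module.Basis ι R U → Module.Basis J R (obj R U C)),
    ∀ {R S : Type u} [CommRing R] [Differential R] [CommRing S] [Differential S]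
      {φ : R →+* S} (hφ : ∀ r, φ (Differential.deriv r) = Differential.deriv (φ r))
      {U : ModuleCat.{u} R} {V : ModuleCat.{u} S} (f : U →ₛₗ[φ] V)
      (b : Module.Basis ι R U) (c : Module.Basis ι S V), (∀ i, f (b i) = c i) →
      ∀ i, C.map φ hφ f (B b i) = B c i := by
  classical
  -- The index set J and the recipe B are chosen once for all rings, so that bases over F, L and A
  -- can be compared. Finiteness of J is carried along because the dual and the prolongation use it.
  induction C with
  | self => exact ⟨ι, inferInstance, fun b => b, fun _ _ _ _ _ _ hf => hf⟩
  | sum C D hC hD =>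
    obtain ⟨J, _, B, hB⟩ := hC
    obtain ⟨J', _, B', hB'⟩ := hD
    exact ⟨J ⊕ J', inferInstance, fun b => (B b).prod (B' b),
      fun hφ _ _ f b c hf => sumMap_basis _ _ _ (hB hφ f b c hf) _ _ _ (hB' hφ f b c hf)⟩
  | tensor C D hC hD =>
    obtain ⟨J, _, B, hB⟩ := hC
    obtain ⟨J', _, B', hB'⟩ := hD
    exact ⟨J × J', inferInstance, fun b => (B b).tensorProduct (B' b),
      fun hφ _ _ f b c hf => tensorMap_basis _ _ _ (hB hφ f b c hf) _ _ _ (hB' hφ f b c hf)⟩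
  | sym k C hC =>
    obtain ⟨J, _, B, hB⟩ := hC
    exact ⟨_, finite_degree_eq J k, fun b => symPowerBasis (B b) k,
      fun hφ _ _ f b c hf => symMap_basis _ _ _ (hB hφ f b c hf) k⟩
  | alt k C hC =>
    obtain ⟨J, _, B, hB⟩ := hC
    -- The exterior basis needs an order on the indices; any order serves, provided it is the same
    -- over all rings.
    let _ : LinearOrder J := LinearOrder.lift' (Finite.equivFin J) (Finite.equivFin J).injective
    exact ⟨Set.powersetCard J k, inferInstance, fun b => (B b).exteriorPower k,
      fun hφ _ _ f b c hf => extMap_basis _ _ _ (hB hφ f b c hf) k⟩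
  | dual C hC =>
    obtain ⟨J, _, B, hB⟩ := hC
    exact ⟨J, inferInstance, fun b => (B b).dualBasis,
      fun hφ _ _ f b c hf => dualMap_basis _ _ _ (hB hφ f b c hf)⟩
  | prol C hC =>
    obtain ⟨J, _, B, hB⟩ := hC
    cases nonempty_fintype J
    exact ⟨J ⊕ J, inferInstance, fun b => prolBasis (B b),
      fun hφ _ _ f b c hf => prolMap_basis hφ _ _ _ (hB hφ f b c hf)⟩

section Functoriality

variable {R S T : Type u} [CommRing R] [Differential R] [CommRing S] [Differential S]
  [CommRing T] [Differential T] {φ : R →+* S} {χ : S →+* T} {θ : R →+* T}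
  (hφ : ∀ r, φ (Differential.deriv r) = Differential.deriv (φ r))
  (hχ : ∀ r, χ (Differential.deriv r) = Differential.deriv (χ r))
  (hθ : ∀ r, θ (Differential.deriv r) = Differential.deriv (θ r))
  {U : ModuleCat.{u} R} {V : ModuleCat.{u} S} {W : ModuleCat.{u} T}

/-- Both sides are semilinear and agree on the basis given by `exists_basis`. The hypotheses on
bases are there because `dualMap` is only meaningful for maps sending a basis to a basis. -/
theorem map_map [RingHomCompTriple φ χ θ] {ι : Type} [Finite ι] (f : U →ₛₗ[φ] V)
    (g : V →ₛₗ[χ] W) (h : U →ₛₗ[θ] W) (b : Module.Basis ι R U) (c : Module.Basis ι S V)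
    (d : Module.Basis ι T W) (hf : ∀ i, f (b i) = c i) (hg : ∀ i, g (c i) = d i)
    (hh : ∀ i, h (b i) = d i) (C : Construction) (x : obj R U C) :
    C.map χ hχ g (C.map φ hφ f x) = C.map θ hθ h x := by
  obtain ⟨J, _, B, hB⟩ := exists_basis ι C
  have : (C.map χ hχ g).comp (C.map φ hφ f) = C.map θ hθ h := by
    refine (B b).ext fun i => ?_
    rw [LinearMap.comp_apply, hB hφ f b c hf, hB hχ g c d hg, hB hθ h b d hh]
  exact LinearMap.congr_fun this x

theorem map_id {ι : Type} [Finite ι] (b : Module.Basis ι R U) (C : Construction) (x : obj R U C) :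
    C.map (RingHom.id R) (fun _ => rfl) (LinearMap.id : U →ₗ[R] U) x = x := by
  obtain ⟨J, _, B, hB⟩ := exists_basis ι C
  have : C.map (RingHom.id R) (fun _ => rfl) (LinearMap.id : U →ₗ[R] U) = LinearMap.id :=
    (B b).ext fun i => hB _ _ b b (fun _ => rfl) i
  exact LinearMap.congr_fun this x

end Functoriality

end Construction

/-! ### Semilinear maps and bases. -/

section SemilinearBasis

variable {R S U V : Type*} [CommRing R] [CommRing S] [AddCommGroup U] [Module R U]
  [AddCommGroup V] [Module S V] {ι : Type*} [Fintype ι]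

/-- The `φ`-semilinear map with prescribed values on a basis. -/
def semilinearOfBasis (φ : R →+* S) (b : Module.Basis ι R U) (v : ι → V) : U →ₛₗ[φ] V where
  toFun x := ∑ i, φ (b.repr x i) • v i
  map_add' x y := by simp [add_smul, Finset.sum_add_distrib]
  map_smul' r x := by simp [mul_smul, Finset.smul_sum]

theorem semilinearOfBasis_apply (φ : R →+* S) (b : Module.Basis ι R U) (v : ι → V) (x : U) :
    semilinearOfBasis φ b v x = ∑ i, φ (b.repr x i) • v i := rfl

/-- A semilinear map that sends one basis to a basis sends every basis to a basis. -/
theorem exists_basis_of_basis {φ : R →+* S} (f : U →ₛₗ[φ] V) (b : Module.Basis ι R U)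
    (c : Module.Basis ι S V) (hf : ∀ i, f (b i) = c i) (e : Module.Basis ι R U) :
    ∃ e' : Module.Basis ι S V, ∀ i, f (e i) = e' i := by
  classical
  -- The change of basis from b to e is invertible and φ preserves units, so its image under φ is a
  -- change of basis from c.
  have hdet : IsUnit ((b.toMatrix e).map φ).det := by
    let _ := b.invertibleToMatrix e
    have := (Matrix.isUnit_det_of_invertible (b.toMatrix e)).map φ
    rwa [RingHom.map_det] at this
  refine ⟨c.map (Matrix.toLinearEquiv c _ hdet), fun j => ?_⟩
  rw [Module.Basis.map_apply, Matrix.toLinearEquiv_apply, Matrix.toLin_self]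
  conv_lhs => rw [← b.sum_repr (e j), map_sum]
  exact Finset.sum_congr rfl fun i _ => by rw [map_smulₛₗ, hf]; rfl

/-- Stated by membership because φ need not be surjective, so the image of a submodule need not be a
submodule. -/
theorem map_mem_span_of_mem_span {φ : R →+* S} (f : U →ₛₗ[φ] V) (s : Set U) (t : Submodule S V)
    (h : ∀ x ∈ s, f x ∈ t) {x : U} (hx : x ∈ Submodule.span R s) : f x ∈ t := by
  induction hx using Submodule.span_induction with
  | mem x hx => exact h x hx
  | zero => rw [map_zero]; exact zero_mem _
  | add x y _ _ hx hy => rw [map_add]; exact add_mem hx hy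
  | smul r x _ hx => rw [map_smulₛₗ]; exact t.smul_mem _ hx

end SemilinearBasis

/-! ### Descent along a fixed basis. -/

section Descent

variable {L V : Type*} [Field L] {σ : L →+* L} [AddCommGroup V] [Module L V] {J : Type*}

/-- In a fixed basis the operator is σ applied to each coordinate; in particular fixed vectors have
constant coordinates. -/
theorem repr_semilinear (e : Module.Basis J L V) (s : V →ₛₗ[σ] V) (hs : ∀ j, s (e j) = e j)
    (v : V) (j : J) : e.repr (s v) j = σ (e.repr v j) := by
  conv_lhs => rw [← e.linearCombination_repr v, Finsupp.linearCombination_apply, Finsupp.sum,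
    map_sum]
  simp_rw [map_smulₛₗ, hs, map_sum, map_smul, Module.Basis.repr_self]
  rw [Finsupp.finsetSum_apply]
  classical
  simp only [Finsupp.smul_apply, Finsupp.single_apply, smul_eq_mul, mul_ite, mul_one, mul_zero,
    Finset.sum_ite_eq', Finsupp.mem_support_iff, ne_eq, ite_not]
  split_ifs with h
  · rw [h, map_zero]
  · rfl

/-- Descent: a subspace stable under a semilinear operator that fixes a basis is spanned by its
fixed vectors. -/
theorem le_span_fixed (e : Module.Basis J L V) (s : V →ₛₗ[σ] V) (hs : ∀ j, s (e j) = e j)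
    (N : Submodule L V) (hN : ∀ v ∈ N, s v ∈ N) :
    N ≤ Submodule.span L {v | v ∈ N ∧ s v = v} := by
  classical
  set T := Submodule.span L {v | v ∈ N ∧ s v = v} with hT
  have hTN : T ≤ N := Submodule.span_le.2 fun v hv => hv.1
  -- Minimal support argument, valid for infinite J since supports are finite. Once a coordinate of
  -- v' is scaled to 1, it vanishes in s v' - v', because σ(1) = 1; so either v' is fixed or s v' -
  -- v' is a nonzero vector of N with smaller support.
  have exists_fixed : ∀ n, ∀ v ∈ N, v ≠ 0 → (e.repr v).support.card = n →
      ∃ w ∈ T, w ≠ 0 ∧ (e.repr w).support ⊆ (e.repr v).support := by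
    intro n
    induction n using Nat.strong_induction_on with
    | _ n ih =>
      intro v hv hv0 hn
      obtain ⟨i, hi⟩ : ∃ i, e.repr v i ≠ 0 := by
        by_contra! h
        exact hv0 (e.repr.map_eq_zero_iff.1 (Finsupp.ext h))
      set v' := (e.repr v i)⁻¹ • v with hv'
      have hv'N : v' ∈ N := N.smul_mem _ hv
      have hv'i : e.repr v' i = 1 := by simp [hv', hi]
      have hsupp : (e.repr v').support ⊆ (e.repr v).support := by
        rw [hv', map_smul]; exact Finsupp.support_smul
      by_cases hfix : s v' = v'
      · refine ⟨v', Submodule.subset_span ⟨hv'N, hfix⟩, ?_, hsupp⟩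
        rintro h
        rw [h] at hv'i
        simp at hv'i
      · have hd : (e.repr (s v' - v')).support ⊂ (e.repr v).support := by
          refine Finset.ssubset_iff_subset_ne.2 ⟨fun j hj => hsupp ?_, fun h => ?_⟩
          · rw [Finsupp.mem_support_iff] at hj ⊢
            intro h0
            apply hj
            rw [map_sub, Finsupp.sub_apply, repr_semilinear e s hs, h0, map_zero, sub_zero]
          · have : i ∈ (e.repr v).support := Finsupp.mem_support_iff.2 hi
            rw [← h, Finsupp.mem_support_iff, map_sub, Finsupp.sub_apply, repr_semilinear e s hs,
              hv'i, map_one, sub_self] at this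
            exact this rfl
        obtain ⟨w, hw, hw0, hws⟩ := ih _ (hn ▸ Finset.card_lt_card hd) (s v' - v')
          (sub_mem (hN _ hv'N) hv'N) (sub_ne_zero.2 hfix) rfl
        exact ⟨w, hw, hw0, hws.trans hd.subset⟩
  -- Subtracting a multiple of w cancels a coordinate of v without enlarging the support.
  have main : ∀ n, ∀ v ∈ N, (e.repr v).support.card = n → v ∈ T := by
    intro n
    induction n using Nat.strong_induction_on with
    | _ n ih =>
      intro v hv hn
      by_cases hv0 : v = 0
      · rw [hv0]; exact zero_mem _
      obtain ⟨w, hw, hw0, hws⟩ := exists_fixed _ v hv hv0 rfl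
      obtain ⟨i, hi⟩ : ∃ i, e.repr w i ≠ 0 := by
        by_contra! h
        exact hw0 (e.repr.map_eq_zero_iff.1 (Finsupp.ext h))
      set c := e.repr v i / e.repr w i
      have hd : (e.repr (v - c • w)).support ⊂ (e.repr v).support := by
        refine Finset.ssubset_iff_subset_ne.2 ⟨fun j hj => ?_, fun h => ?_⟩
        · by_contra hj'
          have hjw : j ∉ (e.repr w).support := fun h => hj' (hws h)
          rw [Finsupp.notMem_support_iff] at hj' hjw
          simp [hj', hjw] at hj
        · have : i ∈ (e.repr v).support := hws (Finsupp.mem_support_iff.2 hi)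
          rw [← h, Finsupp.mem_support_iff] at this
          apply this
          simp [c, hi]
      have := ih _ (hn ▸ Finset.card_lt_card hd) (v - c • w)
        (sub_mem hv (N.smul_mem _ (hTN hw))) rfl
      simpa using add_mem this (T.smul_mem c hw)
  exact fun v hv => main _ v hv rfl

end Descent

/-! ### Points of the Galois group obtained from pairs of specializations. -/

namespace QDifferenceModule

variable {F : Type u} [Field F] {σ : F →+* F} (M : QDifferenceModule F σ)

/-- The operator is surjective, so the images of a basis span; counting dimensions, they form a
basis. -/
theorem exists_basis_op {ι : Type*} [Fintype ι] (b : Module.Basis ι F M.carrier) :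
    ∃ c : Module.Basis ι F M.carrier, ∀ i, M.op (b i) = c i := by
  have hspan : ⊤ ≤ Submodule.span F (Set.range fun i => M.op (b i)) := by
    rintro x -
    obtain ⟨y, rfl⟩ := M.bijective_op.2 x
    refine map_mem_span_of_mem_span M.op (Set.range b) _ ?_ (b.mem_span y)
    rintro _ ⟨i, rfl⟩
    exact Submodule.subset_span ⟨i, rfl⟩
  exact ⟨basisOfTopLeSpanOfCardEqFinrank _ hspan (Module.finrank_eq_card_basis b).symm,
    fun i => by rw [coe_basisOfTopLeSpanOfCardEqFinrank]⟩

variable [Differential F] (hσ : ∀ f, σ (Differential.deriv f) = Differential.deriv (σ f))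
  {L : Type u} [Field L] [Algebra F L] [Differential L] [DifferentialAlgebra F L] {σL : L →+* L}
  (A : Type u) [CommRing A] [Algebra F A] [Differential A] [DifferentialAlgebra F A]

/-- If `e` is a basis of solutions of `M` over an extension `L` of `F`, then two differential
specializations of `L` which agree on the constants of `L` differ by an element of the
parameterized generic Galois group. -/
theorem mem_paramGenericGaloisGroup
    (hσL : ∀ f, σL (Differential.deriv f) = Differential.deriv (σL f))
    (hσLF : ∀ f, σL (algebraMap F L f) = algebraMap F L (σ f)) {ι : Type} [Fintype ι]
    (b : Module.Basis ι F M.carrier) (e : Module.Basis ι L (L ⊗[F] M.carrier)) (opL : L ⊗[F] M.carrier →ₛₗ[σL] L ⊗[F] M.carrier)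
    (hopL : ∀ m, opL (1 ⊗ₜ m) = 1 ⊗ₜ M.op m) (he : ∀ i, opL (e i) = e i)
    (φ₁ φ₂ : L →+* A) (hφ₁ : ∀ x, φ₁ (Differential.deriv x) = Differential.deriv (φ₁ x))
    (hφ₂ : ∀ x, φ₂ (Differential.deriv x) = Differential.deriv (φ₂ x))
    (hF₁ : ∀ x, φ₁ (algebraMap F L x) = algebraMap F A x)
    (hF₂ : ∀ x, φ₂ (algebraMap F L x) = algebraMap F A x)
    (hφ : ∀ x, σL x = x → φ₁ x = φ₂ x)
    (f₁ : L ⊗[F] M.carrier →ₛₗ[φ₁] A ⊗[F] M.carrier)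
    (f₂ : L ⊗[F] M.carrier →ₛₗ[φ₂] A ⊗[F] M.carrier)
    (hf₁ : ∀ m, f₁ (1 ⊗ₜ m) = 1 ⊗ₜ m) (hf₂ : ∀ m, f₂ (1 ⊗ₜ m) = 1 ⊗ₜ m)
    (g : LinearMap.GeneralLinearGroup A (A ⊗[F] M.carrier))
    (hg : ∀ i, (g : Module.End A (A ⊗[F] M.carrier)) (f₂ (e i)) = f₁ (e i)) :
    g ∈ M.paramGenericGaloisGroup A hσ := by
  intro C N hN y hy
  have hbase : ∀ (B : Type u) [CommRing B] [Algebra F B] (i : ι),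
      M.toExt B (b i) = b.baseChange B i := fun B _ _ i => (Module.Basis.baseChange_apply ..).symm
  have hb₁ : ∀ i, f₁ (b.baseChange L i) = b.baseChange A i := fun i => by
    rw [Module.Basis.baseChange_apply, Module.Basis.baseChange_apply, hf₁]
  have hb₂ : ∀ i, f₂ (b.baseChange L i) = b.baseChange A i := fun i => by
    rw [Module.Basis.baseChange_apply, Module.Basis.baseChange_apply, hf₂]
  obtain ⟨e₁, he₁⟩ := exists_basis_of_basis f₁ _ _ hb₁ e
  obtain ⟨e₂, he₂⟩ := exists_basis_of_basis f₂ _ _ hb₂ e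
  obtain ⟨c, hc⟩ := M.exists_basis_op b
  have hcL : ∀ i, opL (b.baseChange L i) = c.baseChange L i := fun i => by
    rw [Module.Basis.baseChange_apply, Module.Basis.baseChange_apply, hopL, hc]
  have tri₁ : RingHomCompTriple (algebraMap F L) φ₁ (algebraMap F A) := ⟨RingHom.ext hF₁⟩
  have tri₂ : RingHomCompTriple (algebraMap F L) φ₂ (algebraMap F A) := ⟨RingHom.ext hF₂⟩
  let UL : ModuleCat L := ModuleCat.of L (L ⊗[F] M.carrier)
  let UA : ModuleCat A := ModuleCat.of A (A ⊗[F] M.carrier)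
  let s : M.constrExt L C →ₛₗ[σL] M.constrExt L C := C.map σL hσL (U := UL) (V := UL) opL
  let h₁ : M.constrExt L C →ₛₗ[φ₁] M.constrExt A C := C.map φ₁ hφ₁ (U := UL) (V := UA) f₁
  let h₂ : M.constrExt L C →ₛₗ[φ₂] M.constrExt A C := C.map φ₂ hφ₂ (U := UL) (V := UA) f₂
  have hh₁ : ∀ x, h₁ (M.constrToExt L C x) = M.constrToExt A C x :=
    Construction.map_map _ _ _ (U := ModuleCat.of F M.carrier) (V := UL) (W := UA) _ _ _ b
      (b.baseChange L) (b.baseChange A) (hbase L) hb₁ (hbase A) C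
  have hh₂ : ∀ x, h₂ (M.constrToExt L C x) = M.constrToExt A C x :=
    Construction.map_map _ _ _ (U := ModuleCat.of F M.carrier) (V := UL) (W := UA) _ _ _ b
      (b.baseChange L) (b.baseChange A) (hbase L) hb₂ (hbase A) C
  -- Both composites are C applied to the single semilinear map m ↦ 1 ⊗ Σ(m), over the restriction
  -- of σL to F.
  have hs : ∀ x, s (M.constrToExt L C x) = M.constrToExt L C (M.constrOp hσ C x) := by
    intro x
    have t₁ : RingHomCompTriple (algebraMap F L) σL (σL.comp (algebraMap F L)) := ⟨rfl⟩
    have t₂ : RingHomCompTriple σ (algebraMap F L) (σL.comp (algebraMap F L)) :=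
      ⟨RingHom.ext fun f => (hσLF f).symm⟩
    have hθ : ∀ f, σL.comp (algebraMap F L) (Differential.deriv f) =
        Differential.deriv (σL.comp (algebraMap F L) f) := fun f => by
      rw [RingHom.comp_apply, RingHom.comp_apply, ← hσL, deriv_algebraMap]
    have hcomp : ∀ i, opL.comp (M.toExt L) (b i) = c.baseChange L i := fun i => by
      rw [LinearMap.comp_apply, hbase, hcL]
    have key₁ := Construction.map_map hσL hθ (U := ModuleCat.of F M.carrier) (V := UL) (W := UL)
      (M.toExt L) opL (opL.comp (M.toExt L)) b (b.baseChange L) (c.baseChange L) (hbase L) hcL hcomp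
      (hφ := fun f => (deriv_algebraMap f).symm) C x
    have key₂ := Construction.map_map hσ hθ (U := ModuleCat.of F M.carrier)
      (V := ModuleCat.of F M.carrier) (W := UL) M.op (M.toExt L) (opL.comp (M.toExt L)) b c
      (c.baseChange L) hc (fun i => (Module.Basis.baseChange_apply ..).symm) hcomp
      (hχ := fun f => (deriv_algebraMap f).symm) C x
    exact key₁.trans key₂.symm
  set P := Submodule.span A (M.constrToExt A C '' (N : Set (M.constr C))) with hP
  set Q := Submodule.span L (M.constrToExt L C '' (N : Set (M.constr C))) with hQ
  have hQs : ∀ v ∈ Q, s v ∈ Q := by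
    intro v hv
    refine map_mem_span_of_mem_span s _ _ ?_ hv
    rintro _ ⟨n, hn, rfl⟩
    rw [hs]
    exact Submodule.subset_span ⟨_, hN n hn, rfl⟩
  have hQP : ∀ v ∈ Q, h₁ v ∈ P := by
    intro v hv
    refine map_mem_span_of_mem_span h₁ _ _ ?_ hv
    rintro _ ⟨n, hn, rfl⟩
    rw [hh₁]
    exact Submodule.subset_span ⟨_, hn, rfl⟩
  obtain ⟨J, _, B, hB⟩ := Construction.exists_basis.{u} ι C
  cases nonempty_fintype J
  let BL : Module.Basis J L (M.constrExt L C) := B (U := UL) e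
  have hsB : ∀ j, s (BL j) = BL j := hB hσL (U := UL) (V := UL) opL e e he
  -- All three maps carry adapted bases to adapted bases, so the relation g f₂(e_i) = f₁(e_i)
  -- propagates to every construction.
  have hgB : ∀ j, M.constrAct A g C (h₂ (BL j)) = h₁ (BL j) := fun j => by
    have k₂ : h₂ (BL j) = B (U := UA) e₂ j := hB hφ₂ (U := UL) (V := UA) f₂ e e₂ he₂ j
    have k₁ : h₁ (BL j) = B (U := UA) e₁ j := hB hφ₁ (U := UL) (V := UA) f₁ e e₁ he₁ j
    rw [k₁, k₂]
    exact hB (fun _ => rfl) (U := UA) (V := UA) _ e₂ e₁ (fun i => by rw [← he₂, ← he₁]; exact hg i) j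
  -- The coordinates of v are constants, and φ₁ and φ₂ agree there.
  have hfixed : ∀ v, s v = v → M.constrAct A g C (h₂ v) = h₁ v := by
    intro v hv
    have hcoef : ∀ j, φ₁ (BL.repr v j) = φ₂ (BL.repr v j) := fun j => hφ _ (by
      rw [← repr_semilinear BL s hsB, hv])
    conv_lhs => rw [← BL.sum_repr v]
    conv_rhs => rw [← BL.sum_repr v]
    simp only [map_sum, map_smulₛₗ, hgB, hcoef, RingHom.id_apply]
  -- By descent it suffices to treat fixed vectors of Q, whose images under h₁ are already known to
  -- lie in P.
  have hgQ : ∀ v ∈ Q, M.constrAct A g C (h₂ v) ∈ P := by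
    intro v hv
    have hv' := le_span_fixed BL s hsB Q hQs hv
    refine map_mem_span_of_mem_span h₂ _ (P.comap (M.constrAct A g C)) ?_ hv'
    rintro w ⟨hwQ, hw⟩
    rw [Submodule.mem_comap, hfixed w hw]
    exact hQP w hwQ
  refine map_mem_span_of_mem_span (M.constrAct A g C) _ _ ?_ hy
  rintro _ ⟨n, hn, rfl⟩
  rw [← hh₂]
  exact hgQ _ (Submodule.subset_span ⟨n, hn, rfl⟩)

end QDifferenceModule

/-! ### Differential polynomials, fraction fields and the generic fundamental matrix. -/

section DifferentialExtensions

/-- A section `x ↦ x + D(x) ε` of the projection from the dual numbers defines a derivation. -/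
abbrev differentialOfSection {R : Type u} [CommRing R] (τ : R →+* TrivSqZeroExt R R)
    (hτ : ∀ x, (τ x).fst = x) : Differential R :=
  differentialOfLeibniz (fun x => (τ x).snd) (fun x y => by simp) (fun x y => by
    simp [hτ, mul_comm])

/-- The homomorphism `x ↦ φ(x) + d(x) ε` attached to a derivation `d` along `φ`. -/
def toDual {R S : Type u} [CommRing R] [CommRing S] (φ : R →+* S) (d : R →+ S)
    (hd : ∀ x y, d (x * y) = φ x * d y + φ y * d x) : R →+* TrivSqZeroExt S S where
  toFun x := TrivSqZeroExt.inl (φ x) + TrivSqZeroExt.inr (d x)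
  map_one' := by
    have h := hd 1 1
    simp only [mul_one, map_one, one_mul, left_eq_add] at h
    ext <;> simp [h]
  map_zero' := by ext <;> simp
  map_add' x y := by ext <;> simp
  map_mul' x y := by ext <;> simp [hd, mul_comm]

theorem toDual_apply {R S : Type u} [CommRing R] [CommRing S] (φ : R →+* S) (d : R →+ S)
    (hd : ∀ x y, d (x * y) = φ x * d y + φ y * d x) (x : R) :
    toDual φ d hd x = TrivSqZeroExt.inl (φ x) + TrivSqZeroExt.inr (d x) := rfl

section Polynomials

variable (F : Type u) [Field F] [Differential F] (κ : Type)

/-- The ring of differential polynomials over `F` in the variables `κ`; the variable `(m, k)` is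
the `m`-th derivative of the variable `k`. -/
abbrev DiffPoly : Type u := MvPolynomial (ℕ × κ) F

/-- The section of the dual numbers defining the derivation of `DiffPoly F κ`. -/
def diffPolySection : DiffPoly F κ →+* TrivSqZeroExt (DiffPoly F κ) (DiffPoly F κ) :=
  MvPolynomial.eval₂Hom
    (toDual MvPolynomial.C ((MvPolynomial.C : F →+* DiffPoly F κ).toAddMonoidHom.comp
      (Differential.deriv (R := F)).toLinearMap.toAddMonoidHom) fun x y => by simp)
    fun p => TrivSqZeroExt.inl (MvPolynomial.X p) + TrivSqZeroExt.inr (MvPolynomial.X (p.1 + 1, p.2))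

theorem fst_diffPolySection (p : DiffPoly F κ) : (diffPolySection F κ p).fst = p := by
  have : ((TrivSqZeroExt.fstHom (DiffPoly F κ) (DiffPoly F κ) (DiffPoly F κ)).toRingHom).comp
      (diffPolySection F κ) = RingHom.id _ := by
    refine MvPolynomial.ringHom_ext (fun r => ?_) fun i => ?_ <;>
      simp [diffPolySection, toDual_apply]
  exact RingHom.congr_fun this p

instance diffPolyDifferential : Differential (DiffPoly F κ) :=
  differentialOfSection (diffPolySection F κ) (fst_diffPolySection F κ)

variable {F κ}

theorem diffPoly_deriv (p : DiffPoly F κ) :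
    Differential.deriv p = (diffPolySection F κ p).snd := rfl

theorem diffPoly_deriv_C (f : F) :
    Differential.deriv (MvPolynomial.C f : DiffPoly F κ) =
      MvPolynomial.C (Differential.deriv f) := by
  simp [diffPoly_deriv, diffPolySection, toDual_apply]

theorem diffPoly_deriv_X (m : ℕ) (k : κ) :
    Differential.deriv (MvPolynomial.X (m, k) : DiffPoly F κ) = MvPolynomial.X (m + 1, k) := by
  simp [diffPoly_deriv, diffPolySection]

theorem diffPoly_iterate_deriv_X (m : ℕ) (k : κ) :
    (fun p => Differential.deriv p)^[m] (MvPolynomial.X (0, k) : DiffPoly F κ) =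
      MvPolynomial.X (m, k) := by
  induction m with
  | zero => rfl
  | succ m ih => rw [Function.iterate_succ_apply', ih, diffPoly_deriv_X]

/-- A homomorphism from a ring of differential polynomials to a differential ring commutes with the
derivations if it does on coefficients and variables. -/
theorem diffPolyHom_deriv {S : Type u} [CommRing S] [Differential S] (φ : DiffPoly F κ →+* S)
    (hC : ∀ f, φ (MvPolynomial.C (Differential.deriv f)) =
      Differential.deriv (φ (MvPolynomial.C f)))
    (hX : ∀ m k, φ (MvPolynomial.X (m + 1, k)) = Differential.deriv (φ (MvPolynomial.X (m, k))))
    (p : DiffPoly F κ) : φ (Differential.deriv p) = Differential.deriv (φ p) := by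
  induction p using MvPolynomial.induction_on with
  | C a => rw [diffPoly_deriv_C, hC]
  | add p r hp hr => simp only [map_add, hp, hr]
  | mul_X p i hp => rw [deriv_mul, map_add, map_mul, map_mul, map_mul, deriv_mul, hp,
      diffPoly_deriv_X, hX]

/-- The differential `F`-algebra endomorphism of `F{κ}` with prescribed values on the variables. -/
def diffPolyEnd (z : κ → DiffPoly F κ) : DiffPoly F κ →ₐ[F] DiffPoly F κ :=
  MvPolynomial.aeval fun p => (fun p => Differential.deriv p)^[p.1] (z p.2)

theorem diffPolyEnd_X (z : κ → DiffPoly F κ) (m : ℕ) (k : κ) :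
    diffPolyEnd z (MvPolynomial.X (m, k)) = (fun p => Differential.deriv p)^[m] (z k) := by
  simp [diffPolyEnd]

theorem diffPolyEnd_deriv (z : κ → DiffPoly F κ) (p : DiffPoly F κ) :
    diffPolyEnd z (Differential.deriv p) = Differential.deriv (diffPolyEnd z p) := by
  refine diffPolyHom_deriv (diffPolyEnd z).toRingHom (fun f => ?_) (fun m k => ?_) p
  · have h : ∀ f, diffPolyEnd z (MvPolynomial.C f) = MvPolynomial.C f :=
      fun f => (diffPolyEnd z).commutes f
    change diffPolyEnd z _ = Differential.deriv (diffPolyEnd z _)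
    rw [h, h, diffPoly_deriv_C]
  · change diffPolyEnd z _ = Differential.deriv (diffPolyEnd z _)
    rw [diffPolyEnd_X, diffPolyEnd_X, Function.iterate_succ_apply']

/-- These endomorphisms commute with ∂, so the composite is determined by the variables of order
zero. -/
theorem diffPolyEnd_leftInverse (z w : κ → DiffPoly F κ)
    (h : ∀ k, diffPolyEnd w (z k) = MvPolynomial.X (0, k)) :
    Function.LeftInverse (diffPolyEnd w) (diffPolyEnd z) := by
  have : (diffPolyEnd w).comp (diffPolyEnd z) = AlgHom.id F _ := by
    refine MvPolynomial.algHom_ext fun ⟨m, k⟩ => ?_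
    have hit : ∀ (m : ℕ) p, diffPolyEnd w ((fun p => Differential.deriv p)^[m] p) =
        (fun p => Differential.deriv p)^[m] (diffPolyEnd w p) := fun m p => by
      induction m with
      | zero => rfl
      | succ m ih => rw [Function.iterate_succ_apply', diffPolyEnd_deriv, ih,
          Function.iterate_succ_apply']
    rw [AlgHom.comp_apply, diffPolyEnd_X, hit, h, diffPoly_iterate_deriv_X]
    rfl
  exact fun p => AlgHom.congr_fun this p

end Polynomials

section FractionField

variable (P : Type u) [CommRing P] [IsDomain P] [Differential P]

/-- The homomorphism `P → Frac(P)[ε]` attached to the derivation of `P`. -/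
def fractionDual : P →+* TrivSqZeroExt (FractionRing P) (FractionRing P) :=
  toDual (algebraMap P (FractionRing P))
    ((algebraMap P (FractionRing P)).toAddMonoidHom.comp
      (Differential.deriv (R := P)).toLinearMap.toAddMonoidHom) fun x y => by simp

/-- A dual number is a unit once its first component is; the universal property of localization then
extends the derivation without writing the quotient rule. -/
theorem isUnit_fractionDual (x : nonZeroDivisors P) : IsUnit (fractionDual P x) := by
  rw [TrivSqZeroExt.isUnit_iff_isUnit_fst]
  simp [fractionDual, toDual_apply]

/-- The section of the dual numbers over `Frac(P)` defining the derivation of `Frac(P)`. -/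
def fractionSection : FractionRing P →+* TrivSqZeroExt (FractionRing P) (FractionRing P) :=
  IsLocalization.lift (M := nonZeroDivisors P) (isUnit_fractionDual P)

theorem fst_fractionSection (x : FractionRing P) : (fractionSection P x).fst = x := by
  have : ((TrivSqZeroExt.fstHom (FractionRing P) (FractionRing P) (FractionRing P)).toRingHom).comp
      (fractionSection P) = RingHom.id _ := by
    refine IsLocalization.ringHom_ext (nonZeroDivisors P) (RingHom.ext fun p => ?_)
    simp [fractionSection, fractionDual, toDual_apply]
  exact RingHom.congr_fun this x

instance fractionDifferential : Differential (FractionRing P) :=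
  differentialOfSection (fractionSection P) (fst_fractionSection P)

variable {P}

theorem fraction_deriv_algebraMap (p : P) :
    Differential.deriv (algebraMap P (FractionRing P) p) =
      algebraMap P (FractionRing P) (Differential.deriv p) := by
  change (fractionSection P _).snd = _
  simpa [fractionSection, fractionDual, toDual_apply] using
    (Algebra.algebraMap_eq_smul_one (A := FractionRing P) (Differential.deriv p)).symm

/-- Apply the Leibniz rule to x = (x / y) y and cancel φ(y). -/
theorem deriv_div_hom {K S : Type u} [Field K] [Field S] [Differential K] [Differential S]
    (φ : K →+* S) {x y : K} (hy : y ≠ 0)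
    (hx' : φ (Differential.deriv x) = Differential.deriv (φ x))
    (hy' : φ (Differential.deriv y) = Differential.deriv (φ y)) :
    φ (Differential.deriv (x / y)) = Differential.deriv (φ (x / y)) := by
  have h1 := hx'
  conv_lhs at h1 => rw [← div_mul_cancel₀ x hy]
  conv_rhs at h1 => rw [← div_mul_cancel₀ x hy]
  rw [deriv_mul, map_mul φ, deriv_mul, map_add, map_mul, map_mul, hy'] at h1
  exact mul_left_cancel₀ ((map_ne_zero φ).2 hy) (add_left_cancel h1)

theorem fractionMap_deriv (ψ : P →+* P) (hψ : Function.Injective ψ)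
    (hd : ∀ p, ψ (Differential.deriv p) = Differential.deriv (ψ p)) (x : FractionRing P) :
    (IsFractionRing.map hψ : FractionRing P →+* FractionRing P) (Differential.deriv x) =
      Differential.deriv ((IsFractionRing.map hψ : FractionRing P →+* FractionRing P) x) := by
  have hm : ∀ p, (IsFractionRing.map hψ : FractionRing P →+* FractionRing P) (algebraMap P _ p) =
      algebraMap P _ (ψ p) := fun p => IsLocalization.map_eq _ _
  have hp : ∀ p, (IsFractionRing.map hψ : FractionRing P →+* FractionRing P)
      (Differential.deriv (algebraMap P _ p)) = Differential.deriv
        ((IsFractionRing.map hψ : FractionRing P →+* FractionRing P) (algebraMap P _ p)) := fun p => by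
    rw [fraction_deriv_algebraMap, hm, hm, hd, fraction_deriv_algebraMap]
  obtain ⟨p, r, hr, rfl⟩ := IsFractionRing.div_surjective (A := P) x
  exact deriv_div_hom _ (by simpa using nonZeroDivisors.ne_zero hr) (hp p) (hp r)

end FractionField

/-- Every linear difference system over a field with a commuting derivation and endomorphism has a
fundamental matrix of solutions in a differential and difference field extension. -/
theorem exists_fundamental_matrix {F : Type u} [Field F] [Differential F] (σ : F →+* F)
    (hσ : ∀ f, σ (Differential.deriv f) = Differential.deriv (σ f)) {ι : Type} [Fintype ι]
    [DecidableEq ι] (A B : Matrix ι ι F) (hAB : A * B = 1) :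
    ∃ (L : Type u) (_ : Field L) (_ : Algebra F L) (_ : Differential L)
      (_ : DifferentialAlgebra F L) (σL : L →+* L) (Y : Matrix ι ι L),
      (∀ x, σL (Differential.deriv x) = Differential.deriv (σL x)) ∧
      (∀ f, σL (algebraMap F L f) = algebraMap F L (σ f)) ∧ IsUnit Y.det ∧
      Y.map σL = A.map (algebraMap F L) * Y := by
  let P := DiffPoly F (ι × ι)
  let Z : Matrix ι ι P := Matrix.of fun i j => MvPolynomial.X (0, (i, j))
  let act : Matrix ι ι F → ι × ι → P := fun A k => (A.map (algebraMap F P) * Z) k.1 k.2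
  have hact : ∀ A B : Matrix ι ι F, A * B = 1 → ∀ k, diffPolyEnd (act B) (act A k) =
      MvPolynomial.X (0, k) := by
    intro A B hAB k
    have hZ : Z.map (diffPolyEnd (act B)) = B.map (algebraMap F P) * Z := by
      ext1 i j
      exact diffPolyEnd_X _ 0 (i, j)
    have h1 : (A.map (algebraMap F P) * Z).map (diffPolyEnd (act B)) = Z := by
      rw [Matrix.map_mul, hZ, Matrix.map_map, ← Matrix.mul_assoc]
      have : (A.map (⇑(diffPolyEnd (act B)) ∘ ⇑(algebraMap F P))) = A.map (algebraMap F P) := by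
        congr 1
        funext f
        exact (diffPolyEnd (act B)).commutes f
      rw [this, ← Matrix.map_mul, hAB, Matrix.map_one _ (map_zero _) (map_one _), Matrix.one_mul]
    exact congrFun (congrFun h1 k.1) k.2
  -- Z ↦ BZ undoes Z ↦ AZ because AB = 1. Injectivity is what lets ψ extend to the fraction field.
  have hinj : Function.Injective (diffPolyEnd (act A)) :=
    (diffPolyEnd_leftInverse _ _ (hact A B hAB)).injective
  let ψ : P →+* P := (diffPolyEnd (act A)).toRingHom.comp (MvPolynomial.map σ)
  have hψC : ∀ f, ψ (MvPolynomial.C f) = MvPolynomial.C (σ f) := fun f => by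
    change diffPolyEnd (act A) (MvPolynomial.map σ (MvPolynomial.C f)) = _
    rw [MvPolynomial.map_C]
    exact (diffPolyEnd (act A)).commutes _
  have hψX : ∀ m k, ψ (MvPolynomial.X (m, k)) = (fun p => Differential.deriv p)^[m] (act A k) :=
    fun m k => by
      change diffPolyEnd (act A) (MvPolynomial.map σ (MvPolynomial.X _)) = _
      rw [MvPolynomial.map_X, diffPolyEnd_X]
  have hψ : Function.Injective ψ := hinj.comp (MvPolynomial.map_injective σ σ.injective)
  have hψd : ∀ p, ψ (Differential.deriv p) = Differential.deriv (ψ p) :=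
    diffPolyHom_deriv ψ (fun f => by rw [hψC, hψC, diffPoly_deriv_C, hσ]) fun m k => by
      rw [hψX, hψX, Function.iterate_succ_apply']
  have hm : ∀ p, (IsFractionRing.map hψ : FractionRing P →+* FractionRing P) (algebraMap P _ p) =
      algebraMap P _ (ψ p) := fun p => IsLocalization.map_eq _ _
  refine ⟨FractionRing P, inferInstance, inferInstance, inferInstance, ⟨fun f => ?_⟩,
    IsFractionRing.map hψ, Z.map (algebraMap P _), fractionMap_deriv ψ hψ hψd, fun f => ?_, ?_, ?_⟩
  · rw [IsScalarTower.algebraMap_apply F P, IsScalarTower.algebraMap_apply F P,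
      fraction_deriv_algebraMap]
    exact congrArg _ (diffPoly_deriv_C f)
  · rw [IsScalarTower.algebraMap_apply F P, IsScalarTower.algebraMap_apply F P, hm]
    exact congrArg _ (hψC f)
  · rw [← RingHom.mapMatrix_apply, ← RingHom.map_det, isUnit_iff_ne_zero, ne_eq,
      FaithfulSMul.algebraMap_eq_zero_iff]
    intro h
    -- Specializing Z to the identity matrix sends det Z to 1. Only an algebra homomorphism is
    -- needed, so the values on higher derivatives are irrelevant.
    have h1 := congrArg (MvPolynomial.aeval (R := F)
      fun p : ℕ × (ι × ι) => if p.2.1 = p.2.2 then (1 : F) else 0) h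
    rw [AlgHom.map_det, map_zero] at h1
    have : (MvPolynomial.aeval (R := F)
        fun p : ℕ × (ι × ι) => if p.2.1 = p.2.2 then (1 : F) else 0).mapMatrix Z = 1 := by
      ext i j
      simp [Z, Matrix.one_apply]
    rw [this, Matrix.det_one] at h1
    exact one_ne_zero h1
  · ext i j
    have h1 : ψ (Z i j) = (A.map (algebraMap F P) * Z) i j := hψX 0 (i, j)
    change (IsFractionRing.map hψ : FractionRing P →+* FractionRing P) (algebraMap P _ (Z i j)) = _
    rw [hm, h1]
    simp only [Matrix.mul_apply, map_sum, map_mul, Matrix.map_apply]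
    rfl

end DifferentialExtensions

/-! ### The differential algebra L ⊗_E L. -/

section TensorSquare

variable {F L : Type u} [Field F] [Field L] [Algebra F L] (E : IntermediateField F L)

/-- If x ∉ E, some E-linear form f kills 1 but not x; then a ⊗ b ↦ f(a) b separates the two tensors.
-/
theorem mem_of_tmul_one_eq {x : L} (h : x ⊗ₜ[E] (1 : L) = 1 ⊗ₜ[E] x) : x ∈ E := by
  by_contra hx
  have hx1 : x ∉ Submodule.span E {(1 : L)} := by
    rw [Submodule.mem_span_singleton]
    rintro ⟨a, rfl⟩
    apply hx
    rw [IntermediateField.smul_def, smul_eq_mul, mul_one]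
    exact a.2
  obtain ⟨f, hfx, hf⟩ := Submodule.exists_dual_map_eq_bot_of_notMem hx1 inferInstance
  have hf1 : f 1 = 0 := by
    have := Submodule.mem_map_of_mem (f := f) (Submodule.mem_span_singleton_self (R := E) (1 : L))
    rwa [hf, Submodule.mem_bot] at this
  have h1 := congrArg (TensorProduct.lift ((LinearMap.lsmul E L).comp f)) h
  rw [TensorProduct.lift.tmul, TensorProduct.lift.tmul, LinearMap.comp_apply, LinearMap.comp_apply,
    hf1, map_zero, LinearMap.zero_apply, LinearMap.lsmul_apply, IntermediateField.smul_def,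
    smul_eq_mul, mul_one] at h1
  exact hfx (Subtype.ext h1)

variable [Differential L]

/-- The biadditive map `(a, b) ↦ a' ⊗ b + a ⊗ b'`. -/
def tensorDerivAux : L →+ L →+ L ⊗[E] L where
  toFun a :=
    { toFun := fun b => Differential.deriv a ⊗ₜ[E] b + a ⊗ₜ[E] Differential.deriv b
      map_zero' := by simp
      map_add' := fun b c => by simp only [map_add, TensorProduct.tmul_add]; abel }
  map_zero' := by
    refine AddMonoidHom.ext fun c => ?_
    simp
  map_add' a b := by
    refine AddMonoidHom.ext fun c => ?_
    simp only [AddMonoidHom.add_apply, AddMonoidHom.coe_mk, ZeroHom.coe_mk, map_add,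
      TensorProduct.add_tmul]
    abel

theorem tensorDerivAux_apply (a b : L) : tensorDerivAux E a b =
    Differential.deriv a ⊗ₜ[E] b + a ⊗ₜ[E] Differential.deriv b := rfl

/-- The additive map `a ⊗ b ↦ a' ⊗ b + a ⊗ b'` on `L ⊗_E L`, for a differential subfield `E`. -/
def tensorDeriv (hE : ∀ x ∈ E, Differential.deriv x ∈ E) : L ⊗[E] L →+ L ⊗[E] L :=
  TensorProduct.liftAddHom (tensorDerivAux E) fun r a b => by
    -- The map is E-balanced because the extra term ∂(r) has its coefficient in E and so moves
    -- across the tensor sign.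
    have h : ∀ x : L, Differential.deriv (r • x) =
        r • Differential.deriv x + (⟨_, hE r r.2⟩ : E) • x := fun x => by
      simp only [IntermediateField.smul_def, smul_eq_mul, deriv_mul]; ring
    simp only [tensorDerivAux_apply, h, TensorProduct.add_tmul, TensorProduct.tmul_add,
      TensorProduct.smul_tmul]
    abel

theorem tensorDeriv_tmul (hE : ∀ x ∈ E, Differential.deriv x ∈ E) (a b : L) :
    tensorDeriv E hE (a ⊗ₜ b) = Differential.deriv a ⊗ₜ[E] b + a ⊗ₜ[E] Differential.deriv b := rfl

/-- The derivation of `L ⊗_E L`, for a differential subfield `E` of `L`. -/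
abbrev tensorDifferential (hE : ∀ x ∈ E, Differential.deriv x ∈ E) : Differential (L ⊗[E] L) :=
  differentialOfLeibniz (tensorDeriv E hE) (map_add _) (fun f g => by
    induction f with
    | zero => simp
    | add x y hx hy => simp only [add_mul, map_add, hx, hy, mul_add]; abel
    | tmul a b =>
      induction g with
      | zero => simp
      | add x y hx hy => simp only [mul_add, map_add, hx, hy, add_mul]; abel
      | tmul c d =>
        simp only [Algebra.TensorProduct.tmul_mul_tmul, tensorDeriv_tmul, deriv_mul,
          TensorProduct.add_tmul, TensorProduct.tmul_add, mul_add, mul_comm c, mul_comm d]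
        abel)

end TensorSquare

/-! ### From solutions over the compositum of F and the constants to fixed vectors of M. -/

section Solutions

variable {F L : Type u} [Field F] [Field L] [Algebra F L] {σ : F →+* F} {σL : L →+* L}

/-- A space spanned by fixed vectors has a basis of fixed vectors. -/
theorem exists_fixed_basis (V : Type*) [AddCommGroup V] [Module F V] (S : Set V) :
    ∃ (J : Set V) (c : Module.Basis J F (Submodule.span F S)), ∀ j, (c j : V) ∈ S := by
  obtain ⟨t, htS, hspan, hli⟩ := exists_linearIndependent F S
  refine ⟨t, (Module.Basis.span hli).map (LinearEquiv.ofEq _ _ (by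
    rw [Subtype.range_coe, hspan])), fun j => ?_⟩
  simpa [Module.Basis.span_apply] using htS j.2

theorem map_mem_span_constants (hσLF : ∀ f, σL (algebraMap F L f) = algebraMap F L (σ f)) {x : L}
    (hx : x ∈ Submodule.span F {x | σL x = x}) : σL x ∈ Submodule.span F {x | σL x = x} := by
  induction hx using Submodule.span_induction with
  | mem x hx => rw [show σL x = x from hx]; exact Submodule.subset_span hx
  | zero => rw [map_zero]; exact zero_mem _
  | add x y _ _ hx hy => rw [map_add]; exact add_mem hx hy
  | smul r x _ hx =>
    rw [Algebra.smul_def, map_mul, hσLF, ← Algebra.smul_def]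
    exact Submodule.smul_mem _ _ hx

/-- The restriction of `σ` to the `F`-span of the constants. -/
def spanConstants (hσLF : ∀ f, σL (algebraMap F L f) = algebraMap F L (σ f)) :
    Submodule.span F {x | σL x = x} →ₛₗ[σ] Submodule.span F {x | σL x = x} where
  toFun x := ⟨σL x, map_mem_span_constants hσLF x.2⟩
  map_add' x y := Subtype.ext (by simp)
  map_smul' r x := Subtype.ext (by simp [Algebra.smul_def, hσLF])

/-- The constants are closed under multiplication, so their span is already a subalgebra. -/
theorem adjoin_constants_eq_span (σL : L →+* L) :
    Subalgebra.toSubmodule (Algebra.adjoin F {x | σL x = x}) =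
      Submodule.span F {x | σL x = x} := by
  rw [Algebra.adjoin_eq_span]
  congr 1
  exact congrArg (fun s : Submonoid L => (s : Set L)) <| Submonoid.closure_eq
    ({ carrier := {x | σL x = x}, mul_mem' := fun {a b} ha hb => by
        rw [Set.mem_ofPred_eq] at *; rw [map_mul, ha, hb],
       one_mem' := map_one σL } : Submonoid L)

/-- Solutions of a linear difference system in the compositum of `F` and the constants are
`F`-linear combinations of constants. -/
theorem mem_span_constants_of_mem_adjoin
    (hσLF : ∀ f, σL (algebraMap F L f) = algebraMap F L (σ f)) {ι : Type} [Fintype ι]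
    (a : Matrix ι ι F) (Y : Matrix ι ι L) (hY : Y = a.map (algebraMap F L) * Y.map σL)
    (hmem : ∀ i j, Y i j ∈ IntermediateField.adjoin F {x | σL x = x}) (i j : ι) :
    Y i j ∈ Submodule.span F {x | σL x = x} := by
  classical
  set S : Set L := {x | σL x = x} with hS
  set W := Submodule.span F S with hW
  have hWmul : ∀ x ∈ W, ∀ y ∈ W, x * y ∈ W := by
    rw [hW, hS, ← adjoin_constants_eq_span]
    exact fun x hx y hy => mul_mem (S := Subalgebra F L) hx hy
  have hWprod : ∀ (t : Finset (ι × ι)) (f : ι × ι → L), (∀ p, f p ∈ W) → ∏ p ∈ t, f p ∈ W := by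
    rw [hW, hS, ← adjoin_constants_eq_span]
    exact fun t f hf => (Subalgebra.mem_toSubmodule _).2
      (prod_mem fun p _ => (Subalgebra.mem_toSubmodule _).1 (hf p))
  have hfrac : ∀ p : ι × ι, ∃ r ∈ W, ∃ s ∈ W, s ≠ 0 ∧ s * Y p.1 p.2 = r := by
    rintro ⟨i, j⟩
    obtain ⟨r, hr, s, hs, h⟩ := IntermediateField.mem_adjoin_iff_div.1 (hmem i j)
    rw [← Subalgebra.mem_toSubmodule, adjoin_constants_eq_span] at hr hs
    by_cases h0 : s = 0
    · refine ⟨0, zero_mem _, 1, Submodule.subset_span (map_one σL), one_ne_zero, ?_⟩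
      simp [h, h0]
    · exact ⟨r, hr, s, hs, h0, by rw [h, mul_div_cancel₀ _ h0]⟩
  choose r hr d hd hd0 hdY using hfrac
  -- The common denominators of Y relative to W. The aim is a nonzero one that is constant.
  let D : Submodule F L :=
    { carrier := {x | ∀ i j, x * Y i j ∈ W}
      zero_mem' := fun i j => by rw [zero_mul]; exact zero_mem _
      add_mem' := fun {x y} hx hy i j => by rw [add_mul]; exact add_mem (hx i j) (hy i j)
      smul_mem' := fun c x hx i j => by rw [smul_mul_assoc]; exact W.smul_mem _ (hx i j) }
  let s := spanConstants (σL := σL) hσLF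
  obtain ⟨J, c, hc⟩ := exists_fixed_basis (F := F) L S
  have hsc : ∀ j, s (c j) = c j := fun j => Subtype.ext (hc j)
  let N : Submodule F W := D.comap W.subtype
  -- From Y = aσ(Y) one gets σ(v)Y = aσ(vY), and W is stable under σ.
  have hN : ∀ v ∈ N, s v ∈ N := by
    intro v hv i j
    change σL v * Y i j ∈ W
    have h0 : σL v * Y i j = ∑ l, σL v * (a.map (algebraMap F L) i l * Y.map σL l j) := by
      rw [← Finset.mul_sum, ← Matrix.mul_apply, ← hY]
    rw [h0]
    refine sum_mem fun l _ => ?_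
    have h1 : σL v * (a.map (algebraMap F L) i l * Y.map σL l j) = a i l • σL (v * Y l j) := by
      rw [Algebra.smul_def, map_mul, Matrix.map_apply, Matrix.map_apply]; ring
    rw [h1]
    exact W.smul_mem _ (s ⟨_, hv l j⟩).2
  have hle := le_span_fixed c s hsc N hN
  have hprod : (⟨∏ p, d p, hWprod _ _ hd⟩ : W) ∈ N := by
    intro i j
    change (∏ p, d p) * Y i j ∈ W
    rw [← Finset.prod_erase_mul _ _ (Finset.mem_univ (i, j)), mul_assoc, hdY (i, j)]
    exact hWmul _ (hWprod _ _ hd) _ (hr _)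
  obtain ⟨v, ⟨hvN, hv⟩, hv0⟩ : ∃ v, (v ∈ N ∧ s v = v) ∧ v ≠ 0 := by
    by_contra! h
    have hbot : Submodule.span F {v | v ∈ N ∧ s v = v} = ⊥ := Submodule.span_eq_bot.2 h
    have h1 := hle hprod
    rw [hbot, Submodule.mem_bot] at h1
    exact Finset.prod_ne_zero_iff.2 (fun p _ => hd0 p) (congrArg Subtype.val h1)
  have hv0' : (v : L) ≠ 0 := fun h => hv0 (Subtype.ext h)
  have hv' : σL v = v := congrArg Subtype.val hv
  -- The inverse of a constant is again a constant, so Y = v⁻¹(vY) has entries in W.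
  have hinv : (v : L)⁻¹ ∈ W := Submodule.subset_span (by rw [hS, Set.mem_ofPred_eq, map_inv₀, hv'])
  have := hWmul _ hinv _ (hvN i j)
  rwa [Submodule.subtype_apply, inv_mul_cancel_left₀ hv0'] at this

namespace QDifferenceModule

variable (M : QDifferenceModule F σ)

theorem isTrivial_of_span_eq_top (h : Submodule.span F {m | M.op m = m} = ⊤) : M.IsTrivial := by
  obtain ⟨J, c, hc⟩ := exists_fixed_basis (F := F) M.carrier {m | M.op m = m}
  let c' := c.map ((LinearEquiv.ofEq _ _ h).trans Submodule.topEquiv)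
  refine ⟨c'.reindex (c'.indexEquiv (Module.finBasis F M.carrier)), fun i => ?_⟩
  rw [Module.Basis.reindex_apply]
  exact hc _

/-- A module whose solutions lie in the compositum of `F` and the constants is trivial. -/
theorem isTrivial_of_mem_adjoin (hσLF : ∀ f, σL (algebraMap F L f) = algebraMap F L (σ f))
    {ι : Type} [Fintype ι] [DecidableEq ι] (b : Module.Basis ι F M.carrier) (Y : Matrix ι ι L)
    (hdet : IsUnit Y.det)
    (hY : Y = (b.toMatrix fun i => M.op (b i)).map (algebraMap F L) * Y.map σL)
    (hmem : ∀ i j, Y i j ∈ IntermediateField.adjoin F {x | σL x = x}) : M.IsTrivial := by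
  have hW := mem_span_constants_of_mem_adjoin hσLF _ Y hY hmem
  set a := b.toMatrix fun i => M.op (b i) with ha
  set W := Submodule.span F {x | σL x = x} with hWdef
  let s := spanConstants (σL := σL) hσLF
  obtain ⟨J, c, hc⟩ := exists_fixed_basis (F := F) L {x | σL x = x}
  have hsc : ∀ j, s (c j) = c j := fun j => Subtype.ext (hc j)
  let y : ι → ι → W := fun i j => ⟨Y i j, hW i j⟩
  have hy : ∀ l j, y l j = ∑ i, a l i • s (y i j) := by
    intro l j
    refine Subtype.ext ?_
    rw [AddSubmonoidClass.coe_finsetSum]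
    conv_lhs => rw [show (y l j : L) = Y l j from rfl, hY, Matrix.mul_apply]
    refine Finset.sum_congr rfl fun i _ => ?_
    rw [Matrix.map_apply, Matrix.map_apply, ← Algebra.smul_def]
    rfl
  -- Comparing coefficients of each basis constant c_α in y = a s(y) gives, for every column j, a
  -- vector of M over F that is fixed by the operator.
  have hfix : ∀ α j, M.op (∑ i, c.repr (y i j) α • b i) = ∑ i, c.repr (y i j) α • b i := by
    intro α j
    have hop : ∀ i, M.op (b i) = ∑ l, a l i • b l := fun i => (b.sum_repr (M.op (b i))).symm
    simp only [map_sum, map_smulₛₗ, hop, Finset.smul_sum]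
    rw [Finset.sum_comm]
    refine Finset.sum_congr rfl fun l _ => ?_
    rw [hy l j, map_sum, Finsupp.finsetSum_apply, Finset.sum_smul]
    refine Finset.sum_congr rfl fun i _ => ?_
    rw [map_smul, Finsupp.smul_apply, repr_semilinear c s hsc, smul_smul, smul_eq_mul, mul_comm]
  apply M.isTrivial_of_span_eq_top
  -- A linear form killing all fixed vectors kills every coefficient vector of Y, so the row
  -- (f(b_i)) annihilates Y, contradicting the invertibility of Y.
  by_contra hne
  obtain ⟨f, hf0, hf⟩ := Submodule.exists_dual_map_eq_bot_of_lt_top (lt_top_iff_ne_top.2 hne)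
    inferInstance
  have hfm : ∀ m, M.op m = m → f m = 0 := fun m hm => by
    have := Submodule.mem_map_of_mem (f := f) (Submodule.subset_span (R := F) (s := {m | M.op m = m}) hm)
    rwa [hf, Submodule.mem_bot] at this
  have hsum : ∀ j, ∑ i, f (b i) • y i j = 0 := by
    intro j
    refine c.repr.map_eq_zero_iff.1 (Finsupp.ext fun α => ?_)
    have := hfm _ (hfix α j)
    rw [map_sum] at this
    rw [map_sum, Finsupp.finsetSum_apply, Finsupp.zero_apply, ← this]
    refine Finset.sum_congr rfl fun i _ => ?_
    rw [map_smul, map_smul, Finsupp.smul_apply, smul_eq_mul, smul_eq_mul, mul_comm]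
  have hvec : Matrix.vecMul (fun i => algebraMap F L (f (b i))) Y = 0 := by
    funext j
    have := congrArg Subtype.val (hsum j)
    rw [AddSubmonoidClass.coe_finsetSum] at this
    rw [Matrix.vecMul, dotProduct, Pi.zero_apply]
    simpa [Algebra.smul_def, y] using this
  have hzero := Matrix.eq_zero_of_vecMul_eq_zero hdet.ne_zero hvec
  refine hf0 (b.ext fun i => ?_)
  have := congrFun hzero i
  simpa using this

end QDifferenceModule

end Solutions

/-- Extension of scalars for semilinear maps. -/
theorem exists_semilinear_extension {F L B V : Type*} [Field F] [Field L] [Algebra F L]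
    [CommRing B] [Algebra F B] [AddCommGroup V] [Module F V] {ι : Type*} [Fintype ι]
    (b : Module.Basis ι F V) (φ : L →+* B) (τ : F →+* F)
    (hφ : ∀ f, φ (algebraMap F L f) = algebraMap F B (τ f)) (v : V →ₛₗ[τ] V) :
    ∃ f : L ⊗[F] V →ₛₗ[φ] B ⊗[F] V, ∀ m, f (1 ⊗ₜ m) = 1 ⊗ₜ v m := by
  refine ⟨semilinearOfBasis φ (b.baseChange L) fun i => (1 : B) ⊗ₜ[F] v (b i), fun m => ?_⟩
  rw [semilinearOfBasis_apply]
  conv_rhs => rw [← b.sum_repr m, map_sum, TensorProduct.tmul_sum]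
  refine Finset.sum_congr rfl fun i _ => ?_
  rw [Module.Basis.baseChange_repr_tmul, Algebra.smul_def, mul_one, hφ, map_smulₛₗ,
    TensorProduct.tmul_smul, algebraMap_smul]

/-! ### The two implications. -/

namespace QDifferenceModule

variable {F : Type u} [Field F] [Differential F] {σ : F →+* F}
  (hσ : ∀ f, σ (Differential.deriv f) = Differential.deriv (σ f)) (M : QDifferenceModule F σ)

/-- If the parameterized generic Galois group has no nontrivial `A`-points, then the differential
specializations to `A` which agree on constants agree on solutions. -/
theorem map_solution_eq {L : Type u} [Field L] [Algebra F L] [Differential L]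
    [DifferentialAlgebra F L] {σL : L →+* L}
    (hσL : ∀ x, σL (Differential.deriv x) = Differential.deriv (σL x))
    (hσLF : ∀ f, σL (algebraMap F L f) = algebraMap F L (σ f)) {ι : Type} [Fintype ι]
    [DecidableEq ι] (b : Module.Basis ι F M.carrier) (Y : Matrix ι ι L) (hdet : IsUnit Y.det)
    (hY : Y = (b.toMatrix fun i => M.op (b i)).map (algebraMap F L) * Y.map σL)
    (A : Type u) [CommRing A] [Algebra F A] [Differential A] [DifferentialAlgebra F A]
    (φ₁ φ₂ : L →+* A) (hφ₁ : ∀ x, φ₁ (Differential.deriv x) = Differential.deriv (φ₁ x))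
    (hφ₂ : ∀ x, φ₂ (Differential.deriv x) = Differential.deriv (φ₂ x))
    (hF₁ : ∀ x, φ₁ (algebraMap F L x) = algebraMap F A x)
    (hF₂ : ∀ x, φ₂ (algebraMap F L x) = algebraMap F A x)
    (hφ : ∀ x, σL x = x → φ₁ x = φ₂ x) (h : M.paramGenericGaloisGroup A hσ = {1}) (i j : ι) :
    φ₁ (Y i j) = φ₂ (Y i j) := by
  let bL := b.baseChange L
  let e := bL.map (Matrix.toLinearEquiv bL Y hdet)
  have he : ∀ j, e j = ∑ i, Y i j • bL i := fun j => by
    rw [Module.Basis.map_apply, Matrix.toLinearEquiv_apply, Matrix.toLin_self]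
  obtain ⟨opL, hopL⟩ := exists_semilinear_extension b σL σ hσLF M.op
  -- The columns of Y are solutions: this is Y = aσ(Y) read in the basis b.
  have hope : ∀ j, opL (e j) = e j := by
    intro j
    have h1 : ∀ i, opL (bL i) = ∑ l, algebraMap F L (b.toMatrix (fun i => M.op (b i)) l i) • bL l := by
      intro i
      rw [Module.Basis.baseChange_apply, hopL]
      conv_lhs => rw [← b.sum_repr (M.op (b i)), TensorProduct.tmul_sum]
      refine Finset.sum_congr rfl fun l _ => ?_
      rw [Module.Basis.baseChange_apply, algebraMap_smul, TensorProduct.tmul_smul]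
      rfl
    rw [he, map_sum]
    simp only [map_smulₛₗ, h1, Finset.smul_sum]
    rw [Finset.sum_comm]
    refine Finset.sum_congr rfl fun l _ => ?_
    conv_rhs => rw [hY, Matrix.mul_apply, Finset.sum_smul]
    refine Finset.sum_congr rfl fun i _ => ?_
    rw [smul_smul, mul_comm]
    rfl
  obtain ⟨f₁, hf₁⟩ := exists_semilinear_extension b φ₁ (RingHom.id F) hF₁ LinearMap.id
  obtain ⟨f₂, hf₂⟩ := exists_semilinear_extension b φ₂ (RingHom.id F) hF₂ LinearMap.id
  have hb₁ : ∀ i, f₁ (bL i) = b.baseChange A i := fun i => by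
    rw [Module.Basis.baseChange_apply, Module.Basis.baseChange_apply, hf₁]; rfl
  have hb₂ : ∀ i, f₂ (bL i) = b.baseChange A i := fun i => by
    rw [Module.Basis.baseChange_apply, Module.Basis.baseChange_apply, hf₂]; rfl
  obtain ⟨e₁, he₁⟩ := exists_basis_of_basis f₁ bL _ hb₁ e
  obtain ⟨e₂, he₂⟩ := exists_basis_of_basis f₂ bL _ hb₂ e
  -- In the basis b, the matrix of g is φ₁(Y)φ₂(Y)⁻¹; g = 1 therefore means φ₁(Y) = φ₂(Y).
  let g := LinearMap.GeneralLinearGroup.ofLinearEquiv (e₂.equiv e₁ (Equiv.refl _))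
  have hg : ∀ i, (g : Module.End A (A ⊗[F] M.carrier)) (f₂ (e i)) = f₁ (e i) := fun i => by
    rw [he₂, he₁]
    exact e₂.equiv_apply i e₁ (Equiv.refl _)
  have hmem := M.mem_paramGenericGaloisGroup hσ A hσL hσLF b e opL hopL hope φ₁ φ₂ hφ₁ hφ₂ hF₁ hF₂
    hφ f₁ f₂ hf₁ hf₂ g hg
  rw [h, Set.mem_singleton_iff] at hmem
  have key := hg j
  rw [hmem, Units.val_one, Module.End.one_apply, he, map_sum, map_sum] at key
  simp only [map_smulₛₗ, hb₁, hb₂] at key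
  have := congrArg (fun v => (b.baseChange A).repr v i) key
  simp only [map_sum, map_smul, Finsupp.finsetSum_apply, Finsupp.smul_apply,
    Module.Basis.repr_self, Finsupp.single_apply, smul_eq_mul, mul_ite, mul_one, mul_zero,
    Finset.sum_ite_eq', Finset.mem_univ, if_true] at this
  exact this.symm

/-- A module with trivial parameterized generic Galois group is trivial. -/
theorem isTrivial_of_paramGenericGaloisGroup_eq
    (h : ∀ (A : Type u) [CommRing A] [Algebra F A] [Differential A] [DifferentialAlgebra F A],
      M.paramGenericGaloisGroup A hσ = {1}) : M.IsTrivial := by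
  classical
  let b := Module.finBasis F M.carrier
  obtain ⟨c, hc⟩ := M.exists_basis_op b
  have ha : b.toMatrix (fun i => M.op (b i)) = b.toMatrix c := by
    congr 1
    funext i
    exact hc i
  -- With a the matrix of the operator, the system solved is σ(Y) = a⁻¹Y, equivalent to Y = aσ(Y).
  obtain ⟨L, _, _, _, _, σL, Y, hσL, hσLF, hdet, hY⟩ := exists_fundamental_matrix σ hσ
    (c.toMatrix b) (b.toMatrix c) (c.toMatrix_mul_toMatrix_flip b)
  have hY' : Y = (b.toMatrix fun i => M.op (b i)).map (algebraMap F L) * Y.map σL := by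
    rw [hY, ha, ← Matrix.mul_assoc, ← Matrix.map_mul, b.toMatrix_mul_toMatrix_flip c,
      Matrix.map_one _ (map_zero _) (map_one _), Matrix.one_mul]
  refine M.isTrivial_of_mem_adjoin hσLF b Y hdet hY' ?_
  set E := IntermediateField.adjoin F {x | σL x = x} with hE
  -- Constants are stable under ∂ because σL commutes with ∂; the field operations follow from the
  -- Leibniz rule.
  have hEd : ∀ x ∈ E, Differential.deriv x ∈ E := by
    intro x hx
    induction hx using IntermediateField.adjoin_induction with
    | mem x hx =>
      refine IntermediateField.subset_adjoin F _ ?_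
      change σL _ = _
      rw [hσL, show σL x = x from hx]
    | algebraMap x => rw [deriv_algebraMap]; exact E.algebraMap_mem _
    | add x y _ _ hx hy => rw [map_add]; exact add_mem hx hy
    | inv x hxE hx =>
      by_cases h0 : x = 0
      · rw [h0, inv_zero, map_zero]; exact zero_mem _
      have h1 : Differential.deriv x⁻¹ = - (x⁻¹ * x⁻¹ * Differential.deriv x) := by
        have h2 := deriv_mul x x⁻¹
        rw [mul_inv_cancel₀ h0, Derivation.map_one_eq_zero] at h2
        field_simp at h2 ⊢
        linear_combination -h2
      rw [h1]
      exact neg_mem (mul_mem (mul_mem (inv_mem hxE) (inv_mem hxE)) hx)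
    | mul x y hxE hyE hx hy =>
      rw [deriv_mul]
      exact add_mem (mul_mem hxE hy) (mul_mem hyE hx)
  let _ : Differential (L ⊗[E] L) := tensorDifferential E hEd
  have hd : ∀ x y : L, Differential.deriv (x ⊗ₜ[E] y) =
      Differential.deriv x ⊗ₜ[E] y + x ⊗ₜ[E] Differential.deriv y := tensorDeriv_tmul E hEd
  have hF : ∀ f, algebraMap F (L ⊗[E] L) f = algebraMap F L f ⊗ₜ[E] 1 := fun f => rfl
  have hF' : ∀ f, algebraMap F (L ⊗[E] L) f = 1 ⊗ₜ[E] algebraMap F L f := fun f => by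
    rw [hF]
    have := TensorProduct.smul_tmul (R := E) (algebraMap F E f) (1 : L) (1 : L)
    rwa [Algebra.smul_def, mul_one] at this
  let _ : DifferentialAlgebra F (L ⊗[E] L) := ⟨fun f => by
    rw [hF, hF, hd, deriv_algebraMap, Derivation.map_one_eq_zero, TensorProduct.tmul_zero, add_zero]⟩
  let φ₁ : L →+* L ⊗[E] L := (Algebra.TensorProduct.includeLeft : L →ₐ[E] L ⊗[E] L).toRingHom
  let φ₂ : L →+* L ⊗[E] L := (Algebra.TensorProduct.includeRight : L →ₐ[E] L ⊗[E] L).toRingHom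
  have hφ₁ : ∀ x, φ₁ x = x ⊗ₜ[E] 1 := fun x => rfl
  have hφ₂ : ∀ x, φ₂ x = 1 ⊗ₜ[E] x := fun x => rfl
  intro i j
  refine mem_of_tmul_one_eq E ?_
  exact M.map_solution_eq hσ hσL hσLF b Y hdet hY' (L ⊗[E] L) φ₁ φ₂
    (fun x => by rw [hφ₁, hφ₁, hd, Derivation.map_one_eq_zero, TensorProduct.tmul_zero, add_zero])
    (fun x => by rw [hφ₂, hφ₂, hd, Derivation.map_one_eq_zero, TensorProduct.zero_tmul, zero_add])
    (fun f => (hF f).symm) (fun f => (hF' f).symm)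
    (fun x hx => by
      have hxE : x ∈ E := IntermediateField.subset_adjoin F _ hx
      have := TensorProduct.smul_tmul (R := E) (⟨x, hxE⟩ : E) (1 : L) (1 : L)
      rwa [IntermediateField.smul_def, smul_eq_mul, mul_one] at this)
    (h _) i j

/-- The unit of the zeroth exterior power. -/
def extOne (R : Type u) [CommRing R] (U : Type u) [AddCommGroup U] [Module R U] : ⋀[R]^0 U :=
  ⟨1, Submodule.one_le.1 (pow_zero (LinearMap.range (ExteriorAlgebra.ι R))).ge⟩

/-- Every induced map preserves the unit of Λ⁰. This serves alike for the difference operator, the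
extension of scalars and the action of g. -/
theorem map_self_sum_unit {R S : Type u} [CommRing R] [Differential R] [CommRing S] [Differential S]
    {φ : R →+* S} (hφ : ∀ r, φ (Differential.deriv r) = Differential.deriv (φ r))
    {U : ModuleCat.{u} R} {V : ModuleCat.{u} S} (f : U →ₛₗ[φ] V) (u : U) :
    (Construction.sum .self (.alt 0 .self)).map φ hφ f ((u, extOne R U) : U × ⋀[R]^0 U) =
      ((f u, extOne S V) : V × ⋀[S]^0 V) :=
  Prod.ext rfl (Subtype.ext (map_one (extAlgMap f)))

/-- The parameterized generic Galois group of a trivial module is trivial. -/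
theorem paramGenericGaloisGroup_eq_of_isTrivial (h : M.IsTrivial) (A : Type u) [CommRing A]
    [Algebra F A] [Differential A] [DifferentialAlgebra F A] :
    M.paramGenericGaloisGroup A hσ = {1} := by
  obtain ⟨e, he⟩ := h
  refine Set.eq_singleton_iff_unique_mem.2 ⟨fun C N _ y hy => ?_, fun g hg => ?_⟩
  · have : M.constrAct A 1 C y = y :=
      Construction.map_id (U := ModuleCat.of A (A ⊗[F] M.carrier)) (e.baseChange A) C y
    rwa [this]
  · refine Units.ext ((e.baseChange A).ext fun i => ?_)
    rw [Module.Basis.baseChange_apply, Units.val_one, Module.End.one_apply]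
    -- The line of e_i alone would only make g e_i a multiple of e_i; the extra component in Λ⁰ pins
    -- the scalar down.
    let C := Construction.sum .self (.alt 0 .self)
    let w : M.constr C := ((e i, extOne F M.carrier) : M.carrier × ⋀[F]^0 M.carrier)
    let w' : M.constrExt A C := (((1 : A) ⊗ₜ[F] e i, extOne A (A ⊗[F] M.carrier)) :
      (A ⊗[F] M.carrier) × ⋀[A]^0 (A ⊗[F] M.carrier))
    have hw : M.constrToExt A C w = w' := map_self_sum_unit _ _ _
    have hop : M.constrOp hσ C w = w := (map_self_sum_unit _ _ _).trans (by rw [he])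
    have hgw := hg C (Submodule.span F {w}) (fun n hn =>
      map_mem_span_of_mem_span (M.constrOp hσ C) {w} _ (fun x hx => by
        rw [Set.mem_singleton_iff.1 hx, hop]
        exact Submodule.mem_span_singleton_self w) hn) w'
      (Submodule.subset_span ⟨w, Submodule.mem_span_singleton_self w, hw⟩)
    have hle : Submodule.span A (M.constrToExt A C '' (Submodule.span F {w} : Set (M.constr C))) ≤
        Submodule.span A {w'} := by
      refine Submodule.span_le.2 ?_
      rintro _ ⟨n, hn, rfl⟩
      refine map_mem_span_of_mem_span (M.constrToExt A C) {w} _ (fun x hx => ?_) hn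
      rw [Set.mem_singleton_iff.1 hx, hw]
      exact Submodule.mem_span_singleton_self w'
    obtain ⟨a, ha⟩ := Submodule.mem_span_singleton.1 (hle hgw)
    have hact : M.constrAct A g C w' =
        (((g : Module.End A (A ⊗[F] M.carrier)) ((1 : A) ⊗ₜ[F] e i), extOne A (A ⊗[F] M.carrier)) :
          (A ⊗[F] M.carrier) × ⋀[A]^0 (A ⊗[F] M.carrier)) := map_self_sum_unit _ _ _
    rw [hact] at ha
    have h1 : a • (1 : A) ⊗ₜ[F] e i = (g : Module.End A (A ⊗[F] M.carrier)) (1 ⊗ₜ[F] e i) :=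
      congrArg Prod.fst ha
    -- Comparing Λ⁰ components shows that the scalar a is 1.
    have h2 : a • (1 : ExteriorAlgebra A (A ⊗[F] M.carrier)) = 1 :=
      congrArg (fun x => (Prod.snd x : ⋀[A]^0 (A ⊗[F] M.carrier)).1) ha
    rw [← Algebra.algebraMap_eq_smul_one, ExteriorAlgebra.algebraMap_eq_one_iff] at h2
    rw [← h1, h2, one_smul]

end QDifferenceModule

end QDiff

end

theorem mainTheorem10 {K : Type u} [Field K] [CharZero K] (hK : (⊤ : IntermediateField ℚ K).FG)
    (q : K) (hq0 : q ≠ 0) (hq1 : q ≠ 1) (M : QDiff.QDifferenceModule (RatFunc K) (QDiff.sigma q hq0)) :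
    (∀ (A : Type u) [CommRing A] [Algebra (RatFunc K) A] [Differential A]
      [DifferentialAlgebra (RatFunc K) A],
      M.paramGenericGaloisGroup A (QDiff.sigma_deriv q hq0) = {1}) ↔ M.IsTrivial :=
  ⟨M.isTrivial_of_paramGenericGaloisGroup_eq _,
    fun h A _ _ _ _ => M.paramGenericGaloisGroup_eq_of_isTrivial _ h A⟩
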